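/- Let $\sigma\in C^2(\mathbb R,\mathbb R)$ be of one of the following two types. Type I (quadratic-like): $\sigma$ is strictly convex on $\mathbb R$ and attains its minimum at a point $\alpha$. Put $H=\{u<\alpha\}$. Type II (cubic-like): there are $\alpha<\beta$ such that $\sigma'(u)<0$ for $u<\alpha$ and for $u>\beta$, $\sigma'(u)>0$ for $\alpha<u<\beta$, $\sigma''(u)>0$ for $u\le\alpha$, and $\sigma''(u)<0$ for $u\ge\beta$. Put $H=\{u<\alpha\}\cup\{u>\beta\}$. Let $t_0\in\mathbb R$ and let $u,v$ be real functions of class $C^2$ on $[t_0,\infty)\times\mathbb R$ (up to the boundary $t=t_0$), both $1$-periodic in $x$, i.e. $u(t,x+1)=u(t,x)$ and $v(t,x+1)=v(t,x)$ for all $t\ge t_0$ and $x\in\mathbb R$, satisfying $$u_t=-v_x,\qquad v_t=(\sigma(u))_x\qquad\text{on }[t_0,\infty)\times\mathbb R .$$ If $u(t_0,x)\in H$ for every $x\in\mathbb R$ (the initial data are hyperbolic), then $(u,v)$ is constant on $[t_0,\infty)\times\mathbb R$. -/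

import Mathlib

/-- Type I (quadratic-like): `σ` is a `C²` strictly convex function on the real line which
attains its minimum at `α`. The hyperbolic region is then `{u < α}`. -/
structure IsQuadraticLike (σ : ℝ → ℝ) (α : ℝ) : Prop where
  contDiff : ContDiff ℝ 2 σ
  strictConvex : StrictConvexOn ℝ Set.univ σ
  isMin : ∀ u, σ α ≤ σ u

/-- Type II (cubic-like), with critical points `α < β`. The hyperbolic region is then
`{u < α} ∪ {u > β}`. -/
structure IsCubicLike (σ : ℝ → ℝ) (α β : ℝ) : Prop where
  contDiff : ContDiff ℝ 2 σ
  lt : α < β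
  deriv_neg_left : ∀ u, u < α → deriv σ u < 0
  deriv_neg_right : ∀ u, β < u → deriv σ u < 0
  deriv_pos : ∀ u, α < u → u < β → 0 < deriv σ u
  deriv_deriv_pos : ∀ u, u ≤ α → 0 < deriv (deriv σ) u
  deriv_deriv_neg : ∀ u, β ≤ u → deriv (deriv σ) u < 0

/-- `(u, v)` is a `C²` solution of the p-system `u_t = -v_x`, `v_t = (σ(u))_x` on the half-cylinder
`[t₀, ∞) × ℝ/ℤ`, written as a pair of functions of `(t, x)` that are `1`-periodic in `x`.
Only the values at times `t ≥ t₀` matter; the time derivative at `t = t₀` is one-sided. -/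
structure IsPSystemSolution (σ : ℝ → ℝ) (t₀ : ℝ) (u v : ℝ → ℝ → ℝ) : Prop where
  contDiffOn_u : ContDiffOn ℝ 2 (fun p : ℝ × ℝ => u p.1 p.2) (Set.Ici t₀ ×ˢ Set.univ)
  contDiffOn_v : ContDiffOn ℝ 2 (fun p : ℝ × ℝ => v p.1 p.2) (Set.Ici t₀ ×ˢ Set.univ)
  periodic_u : ∀ t, t₀ ≤ t → ∀ x, u t (x + 1) = u t x
  periodic_v : ∀ t, t₀ ≤ t → ∀ x, v t (x + 1) = v t x
  eq_u : ∀ t, t₀ ≤ t → ∀ x,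
    derivWithin (fun s => u s x) (Set.Ici t₀) t = -deriv (fun y => v t y) x
  eq_v : ∀ t, t₀ ≤ t → ∀ x,
    derivWithin (fun s => v s x) (Set.Ici t₀) t = deriv (fun y => σ (u t y)) x

/-! Write s = σ'. Where s(u) < 0 the system is hyperbolic with speeds ±c(u), c = √(-s), and the
Riemann invariants r = v + C(u) and r̄ = -v + C(u), C' = c, are carried to the right and to the
left. The symmetry x → -x, v → -v exchanges them, so only r is studied (`PSol.reflect`). Suppose
that r is not constant at a hyperbolic time. By periodicity r_x > 0 on some interval.

Along right-going characteristics √c · r_x is nondecreasing (Lax). Since r_x is bounded on bounded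
time intervals, c cannot tend to 0 on characteristics that start with r_x > 0: they form a strip
that stays hyperbolic for as long as the solution exists (`PSol.exists_isStrip`). On the strip r
increases in x and has fixed values on the two sides, so by periodicity the width is at most 1. As
s' is only known to be nonnegative, Lax's equation alone does not give blow-up. Instead integrals of
G(u) + l r over the strip are used; their bulk rate of change is at most a negative multiple of the
jump of r, up to boundary flux (`IsStrip.balance`). Two choices of G matter.

With G = exp(u - α) and l = 1 the integral is bounded below, so the sides of the strip must travel
arbitrarily far (`IsStrip.exists_far`). If r and r̄ are both nonconstant, periodic translates of
strip sides of the two families then enclose any given point and later cross. An elliptic state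
cannot arise inside such an enclosure, by a multiplier argument with a cutoff of u
(`PSol.le_of_enclosed`). If r or r̄ is constant, the maximum principle for the other already bounds
u (`PSol.le_of_riem_const`). Hence u ≤ α for all later times.

Then r and r̄ obey the maximum principle forever, so u is bounded below. For u in a bounded range
there is an entropy with G' ≥ 1 whose boundary flux oscillates as little as desired
(`SonicData.exists_entropy`), and the balance limits the life span of a strip
(`IsStrip.exists_life_span`). This contradicts the existence of strips for all times. So r and r̄
are constant, and with them u and v. -/

open Set Filter Topology MeasureTheory

/-! ### Integrals over moving intervals -/

/-- Differentiation under the integral sign over `[0, 1]` for jointly continuous data. -/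
theorem hasDerivAt_integral_unit {F F' : ℝ → ℝ → ℝ} {a b t : ℝ} (ht : t ∈ Ioo a b)
    (hF : ContinuousOn (fun p : ℝ × ℝ => F p.1 p.2) (Ioo a b ×ˢ Icc 0 1))
    (hF' : ContinuousOn (fun p : ℝ × ℝ => F' p.1 p.2) (Ioo a b ×ˢ Icc 0 1))
    (hd : ∀ r ∈ Ioo a b, ∀ y ∈ Icc (0 : ℝ) 1, HasDerivAt (fun q => F q y) (F' r y) r) :
    HasDerivAt (fun r => ∫ y in (0 : ℝ)..1, F r y) (∫ y in (0 : ℝ)..1, F' t y) t := by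
  have slice : ∀ {H : ℝ → ℝ → ℝ}, ContinuousOn (fun p : ℝ × ℝ => H p.1 p.2)
      (Ioo a b ×ˢ Icc 0 1) → ∀ r ∈ Ioo a b, ContinuousOn (H r) (Icc 0 1) := by
    intro H hH r hr
    exact hH.comp (f := fun y => (r, y)) (by fun_prop) (fun y hy => ⟨hr, hy⟩)
  obtain ⟨l, hl, hl'⟩ := exists_between ht.1
  obtain ⟨m, hm, hm'⟩ := exists_between ht.2
  have hsub : Icc l m ⊆ Ioo a b := fun r hr => ⟨hl.trans_le hr.1, hr.2.trans_lt hm'⟩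
  obtain ⟨B, hB⟩ := (isCompact_Icc.prod isCompact_Icc).exists_bound_of_continuousOn
    (hF'.mono (prod_mono hsub (subset_refl (Icc (0 : ℝ) 1))))
  have hu : uIoc (0 : ℝ) 1 ⊆ Icc 0 1 := by
    rw [uIoc_of_le zero_le_one]; exact Ioc_subset_Icc_self
  refine (intervalIntegral.hasDerivAt_integral_of_dominated_loc_of_deriv_le
    (bound := fun _ => B) (s := Icc l m) (Icc_mem_nhds hl' hm) ?_ ?_ ?_ ?_ ?_ ?_).2
  · filter_upwards [isOpen_Ioo.mem_nhds ht] with r hr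
    exact ((slice hF r hr).mono hu).aestronglyMeasurable measurableSet_uIoc
  · exact (by simpa [uIcc_of_le] using slice hF t ht : ContinuousOn (F t) (uIcc 0 1)).intervalIntegrable
  · exact ((slice hF' t ht).mono hu).aestronglyMeasurable measurableSet_uIoc
  · exact Eventually.of_forall fun y hy r hr => hB (r, y) ⟨hr, hu hy⟩
  · exact intervalIntegrable_const
  · exact Eventually.of_forall fun y hy r hr => hd r (hsub hr) y (hu hy)

/-- Continuity of integrals over `[0, 1]` depending on a parameter in a compact interval. -/
theorem continuousOn_integral_unit {F : ℝ → ℝ → ℝ} {a b : ℝ} (hab : a ≤ b)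
    (hF : ContinuousOn (fun p : ℝ × ℝ => F p.1 p.2) (Icc a b ×ˢ Icc 0 1)) :
    ContinuousOn (fun r => ∫ y in (0 : ℝ)..1, F r y) (Icc a b) := by
  have h1 : Continuous (fun p : ℝ × ℝ =>
      F (projIcc a b hab p.1) (projIcc (0 : ℝ) 1 zero_le_one p.2)) := by
    refine hF.comp_continuous (f := fun p : ℝ × ℝ =>
      ((projIcc a b hab p.1 : ℝ), (projIcc (0 : ℝ) 1 zero_le_one p.2 : ℝ))) ?_ ?_
    · exact ((continuous_subtype_val.comp (continuous_projIcc.comp continuous_fst)).prodMk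
        (continuous_subtype_val.comp (continuous_projIcc.comp continuous_snd)))
    · intro p; exact ⟨(projIcc a b hab p.1).2, (projIcc (0 : ℝ) 1 zero_le_one p.2).2⟩
  have h2 := intervalIntegral.continuous_parametric_intervalIntegral_of_continuous' (μ := volume)
    (f := fun r y => F (projIcc a b hab r) (projIcc (0 : ℝ) 1 zero_le_one y)) h1 0 1
  refine h2.continuousOn.congr fun r hr => ?_
  refine intervalIntegral.integral_congr fun y hy => ?_
  rw [uIcc_of_le zero_le_one] at hy
  simp only [projIcc_of_mem hab hr, projIcc_of_mem zero_le_one hy]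

/-- Reparametrisation of an integral over `[l, m]` by `[0, 1]`. -/
theorem integral_eq_integral_unit (f : ℝ → ℝ) (l m : ℝ) :
    ∫ x in l..m, f x = ∫ y in (0 : ℝ)..1, f (l + y * (m - l)) * (m - l) := by
  rw [intervalIntegral.integral_mul_const]
  have h := intervalIntegral.smul_integral_comp_add_mul (a := 0) (b := 1) f (m - l) l
  simp only [mul_zero, add_zero, mul_one, add_sub_cancel, smul_eq_mul] at h
  rw [← h, mul_comm]
  simp only [mul_comm]

/-- The space-time region between two curves over a time set. -/
def between (L R : ℝ → ℝ) (I : Set ℝ) : Set (ℝ × ℝ) := {p | p.1 ∈ I ∧ p.2 ∈ Icc (L p.1) (R p.1)}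

theorem convexCombo_mem {l m y : ℝ} (h : l ≤ m) (hy : y ∈ Icc (0 : ℝ) 1) :
    l + y * (m - l) ∈ Icc l m := by
  constructor <;> nlinarith [hy.1, hy.2]

theorem continuousOn_integral_between {E : ℝ → ℝ → ℝ} {L R : ℝ → ℝ} {a b : ℝ} (hab : a ≤ b)
    (hL : ContinuousOn L (Icc a b)) (hR : ContinuousOn R (Icc a b))
    (hLR : ∀ t ∈ Icc a b, L t ≤ R t)
    (hE : ContinuousOn (fun p : ℝ × ℝ => E p.1 p.2) (between L R (Icc a b))) :
    ContinuousOn (fun t => ∫ x in (L t)..(R t), E t x) (Icc a b) := by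
  rw [funext fun t => integral_eq_integral_unit (E t) (L t) (R t)]
  have hL' : ContinuousOn (fun p : ℝ × ℝ => L p.1) (Icc a b ×ˢ Icc (0 : ℝ) 1) :=
    hL.comp continuousOn_fst fun p hp => hp.1
  have hR' : ContinuousOn (fun p : ℝ × ℝ => R p.1) (Icc a b ×ˢ Icc (0 : ℝ) 1) :=
    hR.comp continuousOn_fst fun p hp => hp.1
  refine continuousOn_integral_unit (F := fun t y => E t (L t + y * (R t - L t)) * (R t - L t)) hab ?_
  refine ContinuousOn.mul ?_ (hR'.sub hL')
  refine hE.comp (f := fun p : ℝ × ℝ => (p.1, L p.1 + p.2 * (R p.1 - L p.1))) ?_ ?_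
  · exact continuousOn_fst.prodMk (hL'.add (continuousOn_snd.mul (hR'.sub hL')))
  · exact fun p hp => ⟨hp.1, convexCombo_mem (hLR _ hp.1) hp.2⟩

/-- Leibniz rule for an integral between two moving end points. -/
theorem hasDerivAt_integral_between {E Et Ex : ℝ → ℝ → ℝ} {L R L' R' : ℝ → ℝ} {a b t : ℝ}
    (ht : t ∈ Ioo a b)
    (hL : ∀ r ∈ Ioo a b, HasDerivAt L (L' r) r) (hR : ∀ r ∈ Ioo a b, HasDerivAt R (R' r) r)
    (hL' : ContinuousOn L' (Ioo a b)) (hR' : ContinuousOn R' (Ioo a b))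
    (hLR : ∀ r ∈ Ioo a b, L r ≤ R r)
    (hE : ∀ p ∈ between L R (Ioo a b), HasFDerivAt (fun q : ℝ × ℝ => E q.1 q.2)
      (Et p.1 p.2 • ContinuousLinearMap.fst ℝ ℝ ℝ + Ex p.1 p.2 • ContinuousLinearMap.snd ℝ ℝ ℝ) p)
    (hEt : ContinuousOn (fun p : ℝ × ℝ => Et p.1 p.2) (between L R (Ioo a b)))
    (hEx : ContinuousOn (fun p : ℝ × ℝ => Ex p.1 p.2) (between L R (Ioo a b))) :
    HasDerivAt (fun r => ∫ x in (L r)..(R r), E r x)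
      ((∫ x in (L t)..(R t), Et t x) + (E t (R t) * R' t - E t (L t) * L' t)) t := by
  rw [funext fun t => integral_eq_integral_unit (E t) (L t) (R t),
    integral_eq_integral_unit (Et t) (L t) (R t)]
  have c1 : ∀ {f : ℝ → ℝ}, ContinuousOn f (Ioo a b) →
      ContinuousOn (fun p : ℝ × ℝ => f p.1) (Ioo a b ×ˢ Icc (0 : ℝ) 1) := fun hf =>
    hf.comp continuousOn_fst fun p hp => hp.1
  have cL := c1 fun r hr => (hL r hr).continuousAt.continuousWithinAt
  have cR := c1 fun r hr => (hR r hr).continuousAt.continuousWithinAt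
  have cL' := c1 hL'
  have cR' := c1 hR'
  have hmap : MapsTo (fun p : ℝ × ℝ => (p.1, L p.1 + p.2 * (R p.1 - L p.1)))
      (Ioo a b ×ˢ Icc (0 : ℝ) 1) (between L R (Ioo a b)) :=
    fun p hp => ⟨hp.1, convexCombo_mem (hLR _ hp.1) hp.2⟩
  have cmap : ContinuousOn (fun p : ℝ × ℝ => (p.1, L p.1 + p.2 * (R p.1 - L p.1)))
      (Ioo a b ×ˢ Icc (0 : ℝ) 1) :=
    continuousOn_fst.prodMk (cL.add (continuousOn_snd.mul (cR.sub cL)))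
  have cE : ContinuousOn (fun p : ℝ × ℝ => E p.1 p.2) (between L R (Ioo a b)) :=
    fun p hp => (hE p hp).continuousAt.continuousWithinAt
  have cE1 := cE.comp cmap hmap
  have cEt1 := hEt.comp cmap hmap
  have cEx1 := hEx.comp cmap hmap
  simp only [Function.comp_def] at cE1 cEt1 cEx1
  set F' : ℝ → ℝ → ℝ := fun r y =>
    (Et r (L r + y * (R r - L r)) + Ex r (L r + y * (R r - L r)) * (L' r + y * (R' r - L' r))) *
      (R r - L r) + E r (L r + y * (R r - L r)) * (R' r - L' r) with hF'
  have key := hasDerivAt_integral_unit (F := fun r y => E r (L r + y * (R r - L r)) * (R r - L r))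
    (F' := F') ht (cE1.mul (cR.sub cL))
    (((cEt1.add (cEx1.mul (cL'.add (continuousOn_snd.mul (cR'.sub cL'))))).mul (cR.sub cL)).add
      (cE1.mul (cR'.sub cL')))
    (fun r hr y hy => by
      have h1 : HasDerivAt (fun q => ((q, L q + y * (R q - L q)) : ℝ × ℝ))
          ((1, L' r + y * (R' r - L' r)) : ℝ × ℝ) r :=
        (hasDerivAt_id r).prodMk ((hL r hr).add (((hR r hr).sub (hL r hr)).const_mul y))
      have h2 := (hE (r, L r + y * (R r - L r)) (hmap (x := (r, y)) ⟨hr, hy⟩)).comp_hasDerivAt r h1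
      have h3 := h2.mul ((hR r hr).sub (hL r hr))
      refine h3.congr_deriv ?_
      simp [hF'])
  refine key.congr_deriv ?_
  have hs : ∀ {H : ℝ → ℝ → ℝ}, ContinuousOn (fun p : ℝ × ℝ => H p.1 p.2) (Ioo a b ×ˢ Icc (0 : ℝ) 1) →
      IntervalIntegrable (H t) volume 0 1 := by
    intro H hH
    refine ContinuousOn.intervalIntegrable ?_
    rw [uIcc_of_le zero_le_one]
    exact hH.comp (f := fun y => (t, y)) (by fun_prop) (fun y hy => ⟨ht, hy⟩)
  have i1 := hs (H := fun t y => Et t (L t + y * (R t - L t)) * (R t - L t)) (cEt1.mul (cR.sub cL))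
  have i2 := hs (H := fun t y => Ex t (L t + y * (R t - L t)) * (R t - L t) *
    (L' t + y * (R' t - L' t)) + E t (L t + y * (R t - L t)) * (R' t - L' t))
    (((cEx1.mul (cR.sub cL)).mul (cL'.add (continuousOn_snd.mul (cR'.sub cL')))).add
      (cE1.mul (cR'.sub cL')))
  -- Apart from the E_t term, the integrand is the exact y-derivative of E · (L' + y(R' - L')),
  -- which integrates to the two end-point terms.
  have hsplit : (∫ y in (0 : ℝ)..1, F' t y) =
      (∫ y in (0 : ℝ)..1, Et t (L t + y * (R t - L t)) * (R t - L t)) +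
      ∫ y in (0 : ℝ)..1, (Ex t (L t + y * (R t - L t)) * (R t - L t) *
        (L' t + y * (R' t - L' t)) + E t (L t + y * (R t - L t)) * (R' t - L' t)) := by
    rw [← intervalIntegral.integral_add i1 i2]
    refine intervalIntegral.integral_congr fun y _ => ?_
    simp only [hF']; ring
  rw [hsplit]
  congr 1
  have hftc := intervalIntegral.integral_eq_sub_of_hasDerivAt
    (f := fun y => E t (L t + y * (R t - L t)) * (L' t + y * (R' t - L' t))) (a := 0) (b := 1)
    (f' := fun y => Ex t (L t + y * (R t - L t)) * (R t - L t) *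
        (L' t + y * (R' t - L' t)) + E t (L t + y * (R t - L t)) * (R' t - L' t))
    (fun y hy => by
      rw [uIcc_of_le zero_le_one] at hy
      have hlin : HasDerivAt (fun q => L t + q * (R t - L t)) (R t - L t) y := by
        simpa using ((hasDerivAt_id y).mul_const (R t - L t)).const_add (L t)
      have hlin' : HasDerivAt (fun q => L' t + q * (R' t - L' t)) (R' t - L' t) y := by
        simpa using ((hasDerivAt_id y).mul_const (R' t - L' t)).const_add (L' t)
      have h2 := (hE (t, L t + y * (R t - L t)) (hmap (x := (t, y)) ⟨ht, hy⟩)).comp_hasDerivAt y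
        ((hasDerivAt_const y t).prodMk hlin)
      refine (h2.mul hlin').congr_deriv ?_
      simp) i2
  rw [hftc]
  simp only [one_mul, zero_mul, add_zero, add_sub_cancel]

/-! ### Maximum principle for periodic transport equations -/

theorem exists_mem_Icc_periodic {f : ℝ → ℝ} (hf : Function.Periodic f 1) (x : ℝ) :
    ∃ y ∈ Icc (0 : ℝ) 1, f y = f x := by
  obtain ⟨y, hy, h⟩ := hf.exists_mem_Ico₀ one_pos x
  exact ⟨y, ⟨hy.1, hy.2.le⟩, h.symm⟩

/-- Maximum principle for transport equations, periodic in space. -/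
theorem le_of_transport {f ft fx g : ℝ → ℝ → ℝ} {t₁ τ M : ℝ}
    (hper : ∀ t ∈ Icc t₁ τ, Function.Periodic (f t) 1)
    (hf : ∀ t ∈ Icc t₁ τ, ∀ x, HasFDerivAt (fun p : ℝ × ℝ => f p.1 p.2)
      (ft t x • ContinuousLinearMap.fst ℝ ℝ ℝ + fx t x • ContinuousLinearMap.snd ℝ ℝ ℝ) (t, x))
    (heq : ∀ t ∈ Icc t₁ τ, ∀ x, ft t x = g t x * fx t x)
    (h0 : ∀ x, f t₁ x ≤ M) : ∀ t ∈ Icc t₁ τ, ∀ x, f t x ≤ M := by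
  intro t ht x
  -- The penalty ε(t - t₁) forces the maximum back to time t₁. At a later maximum f_x = 0, hence f_t
  -- = 0, and the penalised function has time derivative -ε, so it is larger slightly earlier.
  have key : ∀ ε > 0, f t x ≤ M + ε * (t - t₁) := by
    intro ε hε
    have hcont : ContinuousOn (fun p : ℝ × ℝ => f p.1 p.2 - ε * (p.1 - t₁))
        (Icc t₁ τ ×ˢ Icc (0 : ℝ) 1) := by
      refine ContinuousOn.sub (fun p hp => (hf p.1 hp.1 p.2).continuousAt.continuousWithinAt) ?_
      fun_prop
    obtain ⟨⟨t', x'⟩, ⟨ht', hx'⟩, hmax⟩ := (isCompact_Icc.prod isCompact_Icc).exists_isMaxOn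
      ⟨(t, 0), ht, by simp⟩ hcont
    have hmax' : ∀ r ∈ Icc t₁ τ, ∀ y, f r y - ε * (r - t₁) ≤ f t' x' - ε * (t' - t₁) := by
      intro r hr y
      obtain ⟨z, hz, hzy⟩ := exists_mem_Icc_periodic (hper r hr) y
      have := hmax (a := (r, z)) ⟨hr, hz⟩
      simp only [mem_ofPred_eq] at this
      rwa [hzy] at this
    simp only at ht' hx'
    have hx0 : HasDerivAt (f t') (fx t' x') x' := by
      have := (hf t' ht' x').comp_hasDerivAt x' ((hasDerivAt_const x' t').prodMk (hasDerivAt_id x'))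
      refine this.congr_deriv ?_
      simp
    have hfx : fx t' x' = 0 := by
      refine IsLocalMax.hasDerivAt_eq_zero (Eventually.of_forall fun y => ?_) hx0
      linarith [hmax' t' ht' y]
    have ht0 : HasDerivAt (fun r => f r x') (ft t' x') t' := by
      have := (hf t' ht' x').comp_hasDerivAt t' ((hasDerivAt_id t').prodMk (hasDerivAt_const t' x'))
      refine this.congr_deriv ?_
      simp
    rw [heq t' ht' x', hfx, mul_zero] at ht0
    rcases eq_or_lt_of_le ht'.1 with h | h
    · have h1 := hmax' t ht x
      have h2 := h0 x'
      rw [← h] at h1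
      linarith
    · exfalso
      have hd : HasDerivAt (fun r => f r x' - ε * (r - t₁)) (-ε) t' := by
        have := ht0.sub (((hasDerivAt_id t').sub_const t₁).const_mul ε)
        simpa using! this
      have hlt : ∀ᶠ r in 𝓝[<] t', -ε / 2 > slope (fun r => f r x' - ε * (r - t₁)) t' r := by
        have := (hasDerivAt_iff_tendsto_slope.1 hd).mono_left
          (nhdsWithin_mono t' (fun r (hr : r < t') => hr.ne))
        exact this.eventually (gt_mem_nhds (by linarith))
      have hgt : ∀ᶠ r in 𝓝[<] t', r ∈ Ioo t₁ t' := Ioo_mem_nhdsLT h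
      obtain ⟨r, hr1, hr2⟩ := (hlt.and hgt).exists
      have h3 := hmax' r ⟨hr2.1.le, hr2.2.le.trans ht'.2⟩ x'
      rw [slope_def_field, gt_iff_lt, div_lt_iff_of_neg (by linarith [hr2.2])] at hr1
      nlinarith [hr2.2]
  have hlim : Tendsto (fun ε : ℝ => M + ε * (t - t₁)) (𝓝[>] 0) (𝓝 (M + 0 * (t - t₁))) :=
    Tendsto.mono_left (Continuous.tendsto (by fun_prop) 0) nhdsWithin_le_nhds
  rw [zero_mul, add_zero] at hlim
  exact ge_of_tendsto hlim (eventually_mem_nhdsWithin.mono fun ε hε => key ε hε)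

/-! ### Sonic point and characteristic speed -/

/-- The derivative `s` of a stress function with a sonic point `α`: negative and strictly
increasing to the left of `α`, nonnegative on a nontrivial interval `[α, β]`. -/
structure SonicData (s s' : ℝ → ℝ) (α β : ℝ) : Prop where
  hasDeriv : ∀ w, HasDerivAt s (s' w) w
  cont : Continuous s'
  mono : StrictMonoOn s (Iic α)
  zero : s α = 0
  lt : α < β
  nonneg : ∀ w ∈ Icc α β, 0 ≤ s w

/-- The characteristic speed, extended by zero beyond the sonic point. -/
noncomputable def speed (s : ℝ → ℝ) (α w : ℝ) : ℝ := √(-s (min w α))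

/-- The primitive of the speed vanishing at the sonic point. -/
noncomputable def speedInt (s : ℝ → ℝ) (α w : ℝ) : ℝ := ∫ y in α..w, speed s α y

namespace SonicData

variable {s s' : ℝ → ℝ} {α β : ℝ}

theorem continuous (h : SonicData s s' α β) : Continuous s :=
  continuous_iff_continuousAt.2 fun w => (h.hasDeriv w).continuousAt

theorem neg_of_lt (h : SonicData s s' α β) {w : ℝ} (hw : w < α) : s w < 0 :=
  h.zero ▸ h.mono hw.le self_mem_Iic hw

theorem nonpos (h : SonicData s s' α β) {w : ℝ} (hw : w ≤ α) : s w ≤ 0 :=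
  h.zero ▸ h.mono.monotoneOn hw self_mem_Iic hw

theorem speed_continuous (h : SonicData s s' α β) : Continuous (speed s α) := by
  have := h.continuous
  unfold speed; fun_prop

theorem speed_nonneg (w : ℝ) : 0 ≤ speed s α w := Real.sqrt_nonneg _

theorem speed_eq_zero (h : SonicData s s' α β) {w : ℝ} (hw : α ≤ w) : speed s α w = 0 := by
  simp [speed, min_eq_right hw, h.zero]

theorem speed_sq (h : SonicData s s' α β) {w : ℝ} (hw : w ≤ α) : speed s α w ^ 2 = -s w := by
  rw [speed, min_eq_left hw, Real.sq_sqrt]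
  linarith [h.nonpos hw]

theorem speed_pos (h : SonicData s s' α β) {w : ℝ} (hw : w < α) : 0 < speed s α w := by
  rw [speed, min_eq_left hw.le]
  exact Real.sqrt_pos.2 (by linarith [h.neg_of_lt hw])

theorem speed_strictAntiOn (h : SonicData s s' α β) : StrictAntiOn (speed s α) (Iic α) := by
  intro x hx y hy hxy
  rw [speed, speed, min_eq_left (mem_Iic.1 hx), min_eq_left (mem_Iic.1 hy)]
  exact Real.sqrt_lt_sqrt (by linarith [h.nonpos hy]) (by linarith [h.mono hx hy hxy])

theorem speed_antitone (h : SonicData s s' α β) : Antitone (speed s α) := by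
  intro x y hxy
  refine Real.sqrt_le_sqrt ?_
  linarith [h.mono.monotoneOn (min_le_right x α) (min_le_right y α) (min_le_min_right α hxy)]

/-- The derivative of the speed below the sonic point. -/
theorem hasDerivAt_speed (h : SonicData s s' α β) {w : ℝ} (hw : w < α) :
    HasDerivAt (speed s α) (-s' w / (2 * speed s α w)) w := by
  have h1 : HasDerivAt (fun w => √(-s w)) (-s' w / (2 * √(-s w))) w :=
    (h.hasDeriv w).neg.sqrt (neg_ne_zero.2 (h.neg_of_lt hw).ne)
  have h2 : speed s α =ᶠ[𝓝 w] fun w => √(-s w) := by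
    filter_upwards [Iio_mem_nhds hw] with y hy
    rw [speed, min_eq_left (le_of_lt hy)]
  rw [h2.eq_of_nhds]
  exact h1.congr_of_eventuallyEq h2

theorem deriv_nonneg (h : SonicData s s' α β) {w : ℝ} (hw : w < α) : 0 ≤ s' w := by
  rw [← (h.hasDeriv w).deriv]
  have h1 : ∀ᶠ y in 𝓝[>] w, 0 ≤ slope s w y := by
    filter_upwards [Ioo_mem_nhdsGT hw] with y hy
    rw [slope_def_field]
    exact div_nonneg (by linarith [h.mono hw.le hy.2.le hy.1]) (by linarith [hy.1])
  have h2 := (hasDerivAt_iff_tendsto_slope.1 (h.hasDeriv w)).mono_left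
    (nhdsWithin_mono w (fun r (hr : r ∈ Ioi w) => (mem_Ioi.1 hr).ne'))
  rw [(h.hasDeriv w).deriv]
  exact ge_of_tendsto h2 h1

theorem hasDerivAt_speedInt (h : SonicData s s' α β) (w : ℝ) :
    HasDerivAt (speedInt s α) (speed s α w) w :=
  intervalIntegral.integral_hasDerivAt_right (h.speed_continuous.intervalIntegrable _ _)
    (h.speed_continuous.stronglyMeasurableAtFilter _ _) h.speed_continuous.continuousAt

theorem speedInt_strictMonoOn (h : SonicData s s' α β) : StrictMonoOn (speedInt s α) (Iic α) := by
  refine strictMonoOn_of_deriv_pos (convex_Iic α)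
    (fun w _ => (h.hasDerivAt_speedInt w).continuousAt.continuousWithinAt) fun w hw => ?_
  rw [interior_Iic] at hw
  rw [(h.hasDerivAt_speedInt w).deriv]
  exact h.speed_pos hw

/-- The primitive of the speed tends to `-∞` at `-∞`. -/
theorem exists_lt_of_speedInt_ge (h : SonicData s s' α β) (K : ℝ) :
    ∃ m < α, ∀ w, K ≤ speedInt s α w → m ≤ w := by
  have hc := h.speed_pos (sub_one_lt α)
  set c₁ := speed s α (α - 1)
  -- Left of α - 1 the speed is at least c₁, so the primitive, nonpositive at α - 1, has dropped
  -- below -(|K| + 1) < K before this point.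
  refine ⟨α - 1 - (|K| + 1) / c₁, ?_, fun w hw => ?_⟩
  · have : 0 < (|K| + 1) / c₁ := by positivity
    linarith
  by_contra! hlt
  have hlt' : (|K| + 1) < (α - 1 - w) * c₁ := by
    rw [← div_lt_iff₀ hc]; linarith
  have hw1 : w < α - 1 := by
    have : 0 < (|K| + 1) / c₁ := by positivity
    linarith
  have hmono : speedInt s α (α - 1) ≤ 0 := by
    have : speedInt s α α = 0 := by simp [speedInt]
    rw [← this]
    exact h.speedInt_strictMonoOn.monotoneOn (by simp) (by simp) (by linarith)
  obtain ⟨y, hy, hy'⟩ := exists_hasDerivAt_eq_slope (speedInt s α) (speed s α) hw1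
    (fun w _ => (h.hasDerivAt_speedInt w).continuousAt.continuousWithinAt)
    (fun w _ => h.hasDerivAt_speedInt w)
  rw [eq_div_iff (by linarith)] at hy'
  have hge : c₁ ≤ speed s α y := h.speed_antitone hy.2.le
  nlinarith [neg_abs_le K]

end SonicData

/-! ### Differentials in the (t, x) plane -/

/-- The linear functional `(dt, dx) ↦ A dt + B dx`. -/
noncomputable def pairing (A B : ℝ) : ℝ × ℝ →L[ℝ] ℝ :=
  A • ContinuousLinearMap.fst ℝ ℝ ℝ + B • ContinuousLinearMap.snd ℝ ℝ ℝ

@[simp] theorem pairing_apply (A B : ℝ) (p : ℝ × ℝ) : pairing A B p = A * p.1 + B * p.2 := by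
  simp [pairing]

theorem HasFDerivAt.along {f : ℝ → ℝ → ℝ} {A B g t : ℝ} {γ : ℝ → ℝ}
    (hf : HasFDerivAt (fun p : ℝ × ℝ => f p.1 p.2) (pairing A B) (t, γ t))
    (hγ : HasDerivAt γ g t) : HasDerivAt (fun r => f r (γ r)) (A + B * g) t := by
  have := hf.comp_hasDerivAt t ((hasDerivAt_id t).prodMk hγ)
  refine this.congr_deriv ?_
  simp

theorem HasFDerivAt.snd_deriv {f : ℝ → ℝ → ℝ} {A B t x : ℝ}
    (hf : HasFDerivAt (fun p : ℝ × ℝ => f p.1 p.2) (pairing A B) (t, x)) :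
    HasDerivAt (f t) B x := by
  have := hf.comp_hasDerivAt x ((hasDerivAt_const x t).prodMk (hasDerivAt_id x))
  refine this.congr_deriv ?_
  simp

theorem HasFDerivAt.fst_deriv {f : ℝ → ℝ → ℝ} {A B t x : ℝ}
    (hf : HasFDerivAt (fun p : ℝ × ℝ => f p.1 p.2) (pairing A B) (t, x)) :
    HasDerivAt (fun r => f r x) A t := by
  have := HasFDerivAt.along (γ := fun _ => x) hf (hasDerivAt_const t x)
  refine this.congr_deriv ?_
  simp

theorem HasFDerivAt.reflect {f : ℝ → ℝ → ℝ} {A B t x : ℝ}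
    (hf : HasFDerivAt (fun p : ℝ × ℝ => f p.1 p.2) (pairing A B) (t, -x)) :
    HasFDerivAt (fun p : ℝ × ℝ => f p.1 (-p.2)) (pairing A (-B)) (t, x) := by
  have hm : HasFDerivAt (fun p : ℝ × ℝ => (p.1, -p.2))
      ((ContinuousLinearMap.fst ℝ ℝ ℝ).prod (-ContinuousLinearMap.snd ℝ ℝ ℝ)) (t, x) :=
    hasFDerivAt_fst.prodMk hasFDerivAt_snd.neg
  have := HasFDerivAt.comp (t, x) (f := fun p : ℝ × ℝ => (p.1, -p.2)) hf hm
  refine this.congr_fderiv ?_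
  ext <;> simp

theorem HasFDerivAt.pairing_add {f g : ℝ × ℝ → ℝ} {A B A' B' : ℝ} {p : ℝ × ℝ}
    (hf : HasFDerivAt f (pairing A B) p) (hg : HasFDerivAt g (pairing A' B') p) :
    HasFDerivAt (fun q => f q + g q) (pairing (A + A') (B + B')) p := by
  refine (hf.add hg).congr_fderiv ?_
  ext <;> simp

theorem HasFDerivAt.pairing_neg {f : ℝ × ℝ → ℝ} {A B : ℝ} {p : ℝ × ℝ}
    (hf : HasFDerivAt f (pairing A B) p) :
    HasFDerivAt (fun q => -f q) (pairing (-A) (-B)) p := by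
  refine hf.neg.congr_fderiv ?_
  ext <;> simp

theorem HasFDerivAt.pairing_mul {f g : ℝ × ℝ → ℝ} {A B A' B' : ℝ} {p : ℝ × ℝ}
    (hf : HasFDerivAt f (pairing A B) p) (hg : HasFDerivAt g (pairing A' B') p) :
    HasFDerivAt (fun q => f q * g q) (pairing (f p * A' + g p * A) (f p * B' + g p * B)) p := by
  refine (hf.mul hg).congr_fderiv ?_
  ext <;> simp

theorem HasDerivAt.comp_pairing {h : ℝ → ℝ} {f : ℝ × ℝ → ℝ} {A B h' : ℝ} {p : ℝ × ℝ}
    (hh : HasDerivAt h h' (f p)) (hf : HasFDerivAt f (pairing A B) p) :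
    HasFDerivAt (fun q => h (f q)) (pairing (h' * A) (h' * B)) p := by
  refine (hh.comp_hasFDerivAt p hf).congr_fderiv ?_
  ext <;> simp

/-! ### Solutions and their Riemann invariants -/

/-- A `C²` solution of `u_t = -v_x`, `v_t = s(u) u_x` for times `t > t₀`, periodic in space,
together with its spatial derivatives of order at most two. -/
structure PSol (s s' : ℝ → ℝ) (t₀ : ℝ) (u v ux vx uxx vxx : ℝ → ℝ → ℝ) : Prop where
  du : ∀ t, t₀ < t → ∀ x,
    HasFDerivAt (fun p : ℝ × ℝ => u p.1 p.2) (pairing (-vx t x) (ux t x)) (t, x)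
  dv : ∀ t, t₀ < t → ∀ x,
    HasFDerivAt (fun p : ℝ × ℝ => v p.1 p.2) (pairing (s (u t x) * ux t x) (vx t x)) (t, x)
  dux : ∀ t, t₀ < t → ∀ x,
    HasFDerivAt (fun p : ℝ × ℝ => ux p.1 p.2) (pairing (-vxx t x) (uxx t x)) (t, x)
  dvx : ∀ t, t₀ < t → ∀ x,
    HasFDerivAt (fun p : ℝ × ℝ => vx p.1 p.2)
      (pairing (s' (u t x) * ux t x ^ 2 + s (u t x) * uxx t x) (vxx t x)) (t, x)
  cuxx : ContinuousOn (fun p : ℝ × ℝ => uxx p.1 p.2) (Ioi t₀ ×ˢ univ)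
  cvxx : ContinuousOn (fun p : ℝ × ℝ => vxx p.1 p.2) (Ioi t₀ ×ˢ univ)
  pu : ∀ t, t₀ < t → Function.Periodic (u t) 1
  pv : ∀ t, t₀ < t → Function.Periodic (v t) 1

/-- The Riemann invariant `v + C(u)`. -/
noncomputable def riem (s : ℝ → ℝ) (α : ℝ) (u v : ℝ → ℝ → ℝ) (t x : ℝ) : ℝ :=
  v t x + speedInt s α (u t x)

/-- The spatial derivative `v_x + c(u) u_x` of the Riemann invariant. -/
noncomputable def riemX (s : ℝ → ℝ) (α : ℝ) (u ux vx : ℝ → ℝ → ℝ) (t x : ℝ) : ℝ :=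
  vx t x + speed s α (u t x) * ux t x

theorem exists_bound_of_periodic {f : ℝ → ℝ → ℝ} {t₁ T : ℝ}
    (hf : ∀ t ∈ Icc t₁ T, ∀ x, ContinuousAt (fun p : ℝ × ℝ => f p.1 p.2) (t, x))
    (hp : ∀ t ∈ Icc t₁ T, Function.Periodic (f t) 1) :
    ∃ M, 0 < M ∧ ∀ t ∈ Icc t₁ T, ∀ x, |f t x| ≤ M := by
  obtain ⟨B, hB⟩ := (isCompact_Icc.prod (isCompact_Icc (a := (0 : ℝ)) (b := 1))
    ).exists_bound_of_continuousOn (f := fun p : ℝ × ℝ => f p.1 p.2) (s := Icc t₁ T ×ˢ Icc (0 : ℝ) 1)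
    (fun p hp => (hf p.1 hp.1 p.2).continuousWithinAt)
  refine ⟨|B| + 1, by positivity, fun t ht x => ?_⟩
  obtain ⟨y, hy, h⟩ := exists_mem_Icc_periodic (hp t ht) x
  have := hB (t, y) ⟨ht, hy⟩
  rw [Real.norm_eq_abs] at this
  rw [← h]
  linarith [le_abs_self B]

theorem exists_bounds_of_periodic {f : ℝ → ℝ} (hf : Continuous f) (hp : Function.Periodic f 1) :
    ∃ a b, (∀ x, f x ≤ f a) ∧ ∀ x, f b ≤ f x := by
  obtain ⟨a, -, ha⟩ := isCompact_Icc.exists_isMaxOn (nonempty_Icc.2 (zero_le_one' ℝ)) hf.continuousOn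
  obtain ⟨b, -, hb⟩ := isCompact_Icc.exists_isMinOn (nonempty_Icc.2 (zero_le_one' ℝ)) hf.continuousOn
  refine ⟨a, b, fun x => ?_, fun x => ?_⟩
  · obtain ⟨y, hy, h⟩ := exists_mem_Icc_periodic hp x
    rw [← h]; exact ha hy
  · obtain ⟨y, hy, h⟩ := exists_mem_Icc_periodic hp x
    rw [← h]; exact hb hy

namespace PSol

variable {s s' : ℝ → ℝ} {α β t₀ : ℝ} {u v ux vx uxx vxx : ℝ → ℝ → ℝ}

/-- Mirror symmetry of the system. It exchanges the two characteristic families, so each result on v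
+ C(u) yields one on -v + C(u). -/
theorem reflect (h : PSol s s' t₀ u v ux vx uxx vxx) :
    PSol s s' t₀ (fun t x => u t (-x)) (fun t x => -v t (-x)) (fun t x => -ux t (-x))
      (fun t x => vx t (-x)) (fun t x => uxx t (-x)) (fun t x => -vxx t (-x)) where
  du t ht x := (h.du t ht (-x)).reflect
  dv t ht x := by
    have := (h.dv t ht (-x)).reflect.pairing_neg
    simpa using this
  dux t ht x := by
    have := (h.dux t ht (-x)).reflect.pairing_neg
    simpa using this
  dvx t ht x := by
    have := (h.dvx t ht (-x)).reflect
    simpa using this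
  cuxx := h.cuxx.comp (f := fun p : ℝ × ℝ => (p.1, -p.2)) (by fun_prop) fun p hp => ⟨hp.1, trivial⟩
  cvxx := (h.cvxx.comp (f := fun p : ℝ × ℝ => (p.1, -p.2)) (by fun_prop)
    fun p hp => ⟨hp.1, trivial⟩).neg
  pu t ht x := by
    have := h.pu t ht (-x - 1)
    simp only [sub_add_cancel] at this
    simp only [this]; congr 1; ring
  pv t ht x := by
    have := h.pv t ht (-x - 1)
    simp only [sub_add_cancel] at this
    simp only [this, show -x - 1 = -(x + 1) by ring]

theorem periodic_ux (h : PSol s s' t₀ u v ux vx uxx vxx) {t : ℝ} (ht : t₀ < t) :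
    Function.Periodic (ux t) 1 := by
  intro x
  have h1 := (h.du t ht (x + 1)).snd_deriv.comp_add_const x 1
  have h2 : (fun y => u t (y + 1)) = u t := funext (h.pu t ht)
  rw [h2] at h1
  exact h1.unique (h.du t ht x).snd_deriv

theorem periodic_vx (h : PSol s s' t₀ u v ux vx uxx vxx) {t : ℝ} (ht : t₀ < t) :
    Function.Periodic (vx t) 1 := by
  intro x
  have h1 := (h.dv t ht (x + 1)).snd_deriv.comp_add_const x 1
  have h2 : (fun y => v t (y + 1)) = v t := funext (h.pv t ht)
  rw [h2] at h1
  exact h1.unique (h.dv t ht x).snd_deriv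

theorem continuous_u (h : PSol s s' t₀ u v ux vx uxx vxx) {t : ℝ} (ht : t₀ < t) :
    Continuous (u t) :=
  continuous_iff_continuousAt.2 fun x => (h.du t ht x).snd_deriv.continuousAt

theorem hasFDerivAt_riem (h : PSol s s' t₀ u v ux vx uxx vxx) (hs : SonicData s s' α β)
    {t : ℝ} (ht : t₀ < t) (x : ℝ) :
    HasFDerivAt (fun p : ℝ × ℝ => riem s α u v p.1 p.2)
      (pairing (s (u t x) * ux t x - speed s α (u t x) * vx t x) (riemX s α u ux vx t x))
      (t, x) := by
  have h1 := HasDerivAt.comp_pairing (f := fun p : ℝ × ℝ => u p.1 p.2) (p := (t, x))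
    (hs.hasDerivAt_speedInt (u t x)) (h.du t ht x)
  have h2 := (h.dv t ht x).pairing_add h1
  rw [mul_neg, ← sub_eq_add_neg] at h2
  exact h2

/-- On u ≤ α one has s = -c², which diagonalises the system: r_t = -c r_x. Beyond α the speed is set
to 0 while s need not vanish, so the hypothesis is essential. -/
theorem riem_transport (hs : SonicData s s' α β) {t x : ℝ} (hu : u t x ≤ α) :
    s (u t x) * ux t x - speed s α (u t x) * vx t x =
      -speed s α (u t x) * riemX s α u ux vx t x := by
  have := hs.speed_sq hu
  rw [riemX]
  linear_combination ux t x * this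

theorem periodic_riem (h : PSol s s' t₀ u v ux vx uxx vxx) {t : ℝ} (ht : t₀ < t) :
    Function.Periodic (riem s α u v t) 1 := fun x => by
  rw [riem, riem, h.pu t ht, h.pv t ht]

theorem continuousAt_riemX (h : PSol s s' t₀ u v ux vx uxx vxx) (hs : SonicData s s' α β)
    {t : ℝ} (ht : t₀ < t) (x : ℝ) :
    ContinuousAt (fun p : ℝ × ℝ => riemX s α u ux vx p.1 p.2) (t, x) :=
  (h.dvx t ht x).continuousAt.add
    ((hs.speed_continuous.continuousAt.comp (h.du t ht x).continuousAt).mul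
      (h.dux t ht x).continuousAt)

theorem periodic_riemX (h : PSol s s' t₀ u v ux vx uxx vxx) {t : ℝ} (ht : t₀ < t) :
    Function.Periodic (riemX s α u ux vx t) 1 := fun x => by
  rw [riemX, riemX, h.pu t ht, h.periodic_ux ht, h.periodic_vx ht]

/-- While the solution stays in `{u ≤ α}`, the Riemann invariant does not exceed its initial
supremum. -/
theorem riem_le (h : PSol s s' t₀ u v ux vx uxx vxx) (hs : SonicData s s' α β) {t₁ τ M : ℝ}
    (ht₁ : t₀ < t₁) (hu : ∀ t ∈ Icc t₁ τ, ∀ x, u t x ≤ α) (h0 : ∀ x, riem s α u v t₁ x ≤ M) :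
    ∀ t ∈ Icc t₁ τ, ∀ x, riem s α u v t x ≤ M :=
  le_of_transport (fun _ ht => h.periodic_riem (ht₁.trans_le ht.1))
    (fun _ ht x => h.hasFDerivAt_riem hs (ht₁.trans_le ht.1) x)
    (fun t ht x => riem_transport hs (hu t ht x)) h0

theorem le_riem (h : PSol s s' t₀ u v ux vx uxx vxx) (hs : SonicData s s' α β) {t₁ τ M : ℝ}
    (ht₁ : t₀ < t₁) (hu : ∀ t ∈ Icc t₁ τ, ∀ x, u t x ≤ α) (h0 : ∀ x, M ≤ riem s α u v t₁ x) :
    ∀ t ∈ Icc t₁ τ, ∀ x, M ≤ riem s α u v t x := by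
  intro t ht x
  refine neg_le_neg_iff.1 (le_of_transport (f := fun t x => -riem s α u v t x) (M := -M)
    (fun _ ht x => ?_) (fun _ ht x => (h.hasFDerivAt_riem hs (ht₁.trans_le ht.1) x).pairing_neg)
    (g := fun t x => -speed s α (u t x)) (fun t ht x => ?_) (fun x => neg_le_neg (h0 x)) t ht x)
  · simp only [h.periodic_riem (ht₁.trans_le ht.1) x]
  · rw [riem_transport hs (hu t ht x)]; ring

/-- The Riemann invariant is constant along characteristics. -/
theorem hasDerivAt_riem_along (h : PSol s s' t₀ u v ux vx uxx vxx) (hs : SonicData s s' α β)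
    {t : ℝ} (ht : t₀ < t) {γ : ℝ → ℝ} (hu : u t (γ t) ≤ α)
    (hγ : HasDerivAt γ (speed s α (u t (γ t))) t) :
    HasDerivAt (fun r => riem s α u v r (γ r)) 0 t := by
  refine ((h.hasFDerivAt_riem hs ht (γ t)).along hγ).congr_deriv ?_
  rw [riem_transport hs hu]; ring

/-- Lax's Riccati equation along characteristics. -/
theorem hasDerivAt_sqrt_speed_mul_riemX (h : PSol s s' t₀ u v ux vx uxx vxx)
    (hs : SonicData s s' α β) {t : ℝ} (ht : t₀ < t) {γ : ℝ → ℝ} (hu : u t (γ t) < α)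
    (hγ : HasDerivAt γ (speed s α (u t (γ t))) t) :
    HasDerivAt (fun r => √(speed s α (u r (γ r))) * riemX s α u ux vx r (γ r))
      (s' (u t (γ t)) / (4 * speed s α (u t (γ t)) * √(speed s α (u t (γ t)))) *
        riemX s α u ux vx t (γ t) ^ 2) t := by
  have hc := hs.speed_pos hu
  have hsq := hs.speed_sq hu.le
  have hu' := (h.du t ht (γ t)).along hγ
  have hux' := (h.dux t ht (γ t)).along hγ
  have hvx' := (h.dvx t ht (γ t)).along hγ
  have hc' := (hs.hasDerivAt_speed hu).comp t hu'
  -- Along the curve u changes at rate c u_x - v_x, the gradient of the opposite invariant up to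
  -- sign. The weight √c is the integrating factor that cancels the product of the two gradients and
  -- leaves only r_x².
  have hb' := hc'.sqrt hc.ne'
  have hw := hvx'.add (hc'.mul hux')
  refine (hb'.mul hw).congr_deriv ?_
  simp only [Function.comp_apply, riemX, Pi.add_apply, Pi.mul_apply]
  have hb := Real.sq_sqrt hc.le
  have hb0 : 0 < √(speed s α (u t (γ t))) := Real.sqrt_pos.2 hc
  set b := √(speed s α (u t (γ t)))
  set c := speed s α (u t (γ t))
  have hS : s (u t (γ t)) = -c ^ 2 := by linarith
  rw [hS]
  clear_value c b
  subst hb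
  field_simp
  ring

end PSol

/-! ### Hyperbolic strips of characteristics -/

/-- A strip between two characteristics of the first family inside the hyperbolic region, on which
the Riemann invariant increases in space. -/
structure IsStrip (s : ℝ → ℝ) (α : ℝ) (u ux vx : ℝ → ℝ → ℝ) (t₁ T a₁ a₂ : ℝ)
    (γ₁ γ₂ : ℝ → ℝ) : Prop where
  init₁ : γ₁ t₁ = a₁
  init₂ : γ₂ t₁ = a₂
  deriv₁ : ∀ t ∈ Icc t₁ T, HasDerivWithinAt γ₁ (speed s α (u t (γ₁ t))) (Icc t₁ T) t
  deriv₂ : ∀ t ∈ Icc t₁ T, HasDerivWithinAt γ₂ (speed s α (u t (γ₂ t))) (Icc t₁ T) t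
  hyp : ∀ t ∈ Icc t₁ T, ∀ x ∈ uIcc (γ₁ t) (γ₂ t), u t x < α ∧ 0 < riemX s α u ux vx t x

namespace PSol

variable {s s' : ℝ → ℝ} {α β t₀ : ℝ} {u v ux vx uxx vxx : ℝ → ℝ → ℝ}

/-- Below α the Riccati coefficient is nonnegative because s increases there. Hyperbolicity is
needed only on the open time interval, which suits a first-exit argument. -/
theorem monotoneOn_lax (h : PSol s s' t₀ u v ux vx uxx vxx)
    (hs : SonicData s s' α β) {t₁ τ : ℝ} (ht₁ : t₀ < t₁) {γ : ℝ → ℝ}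
    (hγc : ContinuousOn γ (Icc t₁ τ))
    (hγ : ∀ t ∈ Ioo t₁ τ, u t (γ t) < α ∧ HasDerivAt γ (speed s α (u t (γ t))) t) :
    MonotoneOn (fun r => √(speed s α (u r (γ r))) * riemX s α u ux vx r (γ r)) (Icc t₁ τ) := by
  have hd : ∀ t ∈ Ioo t₁ τ, _ := fun t ht =>
    h.hasDerivAt_sqrt_speed_mul_riemX hs (ht₁.trans ht.1) (hγ t ht).1 (hγ t ht).2
  have hp : ContinuousOn (fun r => (r, γ r)) (Icc t₁ τ) := continuousOn_id.prodMk hγc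
  refine monotoneOn_of_deriv_nonneg (convex_Icc _ _) ?_ ?_ ?_
  · intro r hr
    have hr0 := ht₁.trans_le hr.1
    have h1 : ContinuousWithinAt (fun r => u r (γ r)) (Icc t₁ τ) r :=
      ContinuousAt.comp_continuousWithinAt (f := fun r => (r, γ r))
        (h.du r hr0 (γ r)).continuousAt (hp r hr)
    have h2 : ContinuousWithinAt (fun r => riemX s α u ux vx r (γ r)) (Icc t₁ τ) r :=
      ContinuousAt.comp_continuousWithinAt (f := fun r => (r, γ r))
        (h.continuousAt_riemX hs hr0 (γ r)) (hp r hr)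
    exact (hs.speed_continuous.continuousAt.comp_continuousWithinAt h1).sqrt.mul h2
  · intro r hr
    rw [interior_Icc] at hr
    exact (hd r hr).differentiableAt.differentiableWithinAt
  · intro r hr
    rw [interior_Icc] at hr
    rw [(hd r hr).deriv]
    have := hs.deriv_nonneg (hγ r hr).1
    have := hs.speed_pos (hγ r hr).1
    positivity

/-- The square root need not be Lipschitz at the sonic point. Truncation at a level η < α gives a
field to which Picard–Lindelöf applies on all of [t₁, T]. -/
theorem lipschitz_truncated_speed (h : PSol s s' t₀ u v ux vx uxx vxx)
    (hs : SonicData s s' α β) {t₁ T η : ℝ} (ht₁ : t₀ < t₁) (hη : η < α) :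
    ∃ K : NNReal, ∀ t ∈ Icc t₁ T, LipschitzWith K fun x => speed s α (min (u t x) η) := by
  obtain ⟨M, hM0, hM⟩ := exists_bound_of_periodic (f := u) (t₁ := t₁) (T := T)
    (fun t ht x => (h.du t (ht₁.trans_le ht.1) x).continuousAt)
    (fun t ht => h.pu t (ht₁.trans_le ht.1))
  obtain ⟨N, hN0, hN⟩ := exists_bound_of_periodic (f := ux) (t₁ := t₁) (T := T)
    (fun t ht x => (h.dux t (ht₁.trans_le ht.1) x).continuousAt)
    (fun t ht => h.periodic_ux (ht₁.trans_le ht.1))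
  have hcont : ContinuousOn (fun w => -s' w / (2 * speed s α w)) (Icc (min (-M) η) η) := by
    refine ContinuousOn.div hs.cont.neg.continuousOn
      (continuous_const.mul hs.speed_continuous).continuousOn fun w hw => ?_
    have := hs.speed_pos (hw.2.trans_lt hη)
    positivity
  obtain ⟨B, hB⟩ := isCompact_Icc.exists_bound_of_continuousOn hcont
  have hlip : LipschitzOnWith (Real.toNNReal B) (speed s α) (Icc (min (-M) η) η) := by
    refine (convex_Icc _ _).lipschitzOnWith_of_nnnorm_hasDerivWithin_le
      (fun w hw => (hs.hasDerivAt_speed (hw.2.trans_lt hη)).hasDerivWithinAt) fun w hw => ?_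
    rw [← NNReal.coe_le_coe, coe_nnnorm]
    exact (hB w hw).trans (Real.le_coe_toNNReal B)
  refine ⟨Real.toNNReal B * Real.toNNReal N, fun t ht => ?_⟩
  have hut : LipschitzWith (Real.toNNReal N) (u t) := by
    refine lipschitzWith_of_nnnorm_deriv_le
      (fun x => (h.du t (ht₁.trans_le ht.1) x).snd_deriv.differentiableAt) fun x => ?_
    rw [(h.du t (ht₁.trans_le ht.1) x).snd_deriv.deriv, ← NNReal.coe_le_coe, coe_nnnorm,
      Real.norm_eq_abs]
    exact (hN t ht x).trans (Real.le_coe_toNNReal N)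
  have hmem : ∀ x, min (u t x) η ∈ Icc (min (-M) η) η := fun x =>
    ⟨min_le_min_right _ (neg_le_of_abs_le (hM t ht x)), min_le_right _ _⟩
  have hmin : LipschitzWith (Real.toNNReal N) fun x => min (u t x) η := hut.min_const η
  refine LipschitzWith.of_dist_le_mul fun x y => ?_
  calc dist (speed s α (min (u t x) η)) (speed s α (min (u t y) η))
      ≤ Real.toNNReal B * dist (min (u t x) η) (min (u t y) η) :=
        hlip.dist_le_mul _ (hmem x) _ (hmem y)
    _ ≤ Real.toNNReal B * (Real.toNNReal N * dist x y) := by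
        gcongr; exact hmin.dist_le_mul x y
    _ = _ := by push_cast; ring

/-- √c · r_x stays above its initial minimum ζ along each curve, while r_x ≤ M on [t₁, T]. So √c ≥
ζ/M, and curves of the truncated field never reach a level η close enough to α; they are therefore
true characteristics. -/
theorem exists_isStrip (h : PSol s s' t₀ u v ux vx uxx vxx)
    (hs : SonicData s s' α β) {t₁ T a₁ a₂ : ℝ} (ht₁ : t₀ < t₁) (hT : t₁ ≤ T)
    (hu : ∀ x, u t₁ x < α) (ha : a₁ ≤ a₂) (hw : ∀ x ∈ Icc a₁ a₂, 0 < riemX s α u ux vx t₁ x) :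
    ∃ γ₁ γ₂, IsStrip s α u ux vx t₁ T a₁ a₂ γ₁ γ₂ := by
  obtain ⟨M, hM0, hM⟩ := exists_bound_of_periodic (f := riemX s α u ux vx) (t₁ := t₁) (T := T)
    (fun t ht x => h.continuousAt_riemX hs (ht₁.trans_le ht.1) x)
    (fun t ht => h.periodic_riemX (ht₁.trans_le ht.1))
  obtain ⟨N, hN0, hN⟩ := exists_bound_of_periodic (f := u) (t₁ := t₁) (T := T)
    (fun t ht x => (h.du t (ht₁.trans_le ht.1) x).continuousAt)
    (fun t ht => h.pu t (ht₁.trans_le ht.1))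
  -- a positive lower bound for the initial values
  have hw1 : Continuous (riemX s α u ux vx t₁) := continuous_iff_continuousAt.2 fun x =>
    ContinuousAt.comp (f := fun x => (t₁, x)) (h.continuousAt_riemX hs ht₁ x)
      (by fun_prop)
  have hz1 : Continuous fun x => √(speed s α (u t₁ x)) * riemX s α u ux vx t₁ x :=
    (hs.speed_continuous.comp (h.continuous_u ht₁)).sqrt.mul hw1
  obtain ⟨x₀, hx₀, hmin⟩ := isCompact_Icc.exists_isMinOn (nonempty_Icc.2 ha) hz1.continuousOn
  obtain ⟨xm, -, hxm, -⟩ := exists_bounds_of_periodic (h.continuous_u ht₁) (h.pu t₁ ht₁)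
  set ζ := √(speed s α (u t₁ x₀)) * riemX s α u ux vx t₁ x₀ with hζ
  have hζ0 : 0 < ζ := mul_pos (Real.sqrt_pos.2 (hs.speed_pos (hu x₀))) (hw x₀ hx₀)
  -- η lies above all initial values of u, so curves start below it, and so near α that reaching it
  -- would give √c · r_x < ζ.
  obtain ⟨η, hη1, hη2, hη3⟩ : ∃ η, u t₁ xm < η ∧ η < α ∧ √(speed s α η) * M < ζ := by
    have hcont : Continuous fun η => √(speed s α η) * M := hs.speed_continuous.sqrt.mul_const M
    have hlim : ∀ᶠ η in 𝓝[<] α, √(speed s α η) * M < ζ := by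
      refine (hcont.tendsto α).mono_left nhdsWithin_le_nhds |>.eventually (gt_mem_nhds ?_)
      simpa [hs.speed_eq_zero le_rfl] using hζ0
    obtain ⟨η, h1, h2⟩ := (hlim.and (Ioo_mem_nhdsLT (hu xm))).exists
    exact ⟨η, h2.1, h2.2, h1⟩
  obtain ⟨K, hK⟩ := h.lipschitz_truncated_speed hs (T := T) ht₁ hη2
  set Lb := Real.toNNReal (speed s α (min (-N) η))
  -- The radius allows for the spread of starting points plus the farthest travel Lb · (T - t₁), so
  -- a single flow serves all of [a₁, a₂] up to time T.
  have hpl : IsPicardLindelof (fun t x => speed s α (min (u t x) η)) (tmin := t₁) (tmax := T)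
      ⟨t₁, left_mem_Icc.2 hT⟩ a₁ (Real.toNNReal (a₂ - a₁) + Lb * Real.toNNReal (T - t₁))
      (Real.toNNReal (a₂ - a₁)) Lb K := by
    refine ⟨fun t ht => (hK t ht).lipschitzOnWith, fun x _ t ht => ?_, fun t ht x _ => ?_, ?_⟩
    · refine ContinuousAt.continuousWithinAt ?_
      exact hs.speed_continuous.continuousAt.comp
        ((h.du t (ht₁.trans_le ht.1) x).fst_deriv.continuousAt.min continuousAt_const)
    · rw [Real.norm_eq_abs, abs_of_nonneg (SonicData.speed_nonneg _),
        Real.coe_toNNReal _ (SonicData.speed_nonneg _)]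
      exact hs.speed_antitone (min_le_min_right _ (neg_le_of_abs_le (hN t ht x)))
    · simp only [sub_self, NNReal.coe_add, NNReal.coe_mul, add_sub_cancel_left]
      rw [max_eq_left (by linarith), Real.coe_toNNReal (T - t₁) (by linarith)]
  obtain ⟨Γ, hΓ, L', hL'⟩ :=
    hpl.exists_forall_mem_closedBall_eq_hasDerivWithinAt_lipschitzOnWith
  have hball : Icc a₁ a₂ ⊆ Metric.closedBall a₁ (Real.toNNReal (a₂ - a₁)) := by
    intro x hx
    rw [Metric.mem_closedBall, Real.dist_eq, abs_of_nonneg (by linarith [hx.1]),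
      Real.coe_toNNReal _ (by linarith)]
    linarith [hx.2]
  -- the curves never reach the truncation level
  have main : ∀ a ∈ Icc a₁ a₂, ∀ t ∈ Icc t₁ T, u t (Γ a t) < η ∧
      0 < riemX s α u ux vx t (Γ a t) := by
    intro a ha'
    obtain ⟨hinit, hder⟩ := hΓ a (hball ha')
    simp only at hinit
    have hcont : ContinuousOn (Γ a) (Icc t₁ T) := fun t ht => (hder t ht).continuousWithinAt
    have hgcont : ContinuousOn (fun t => u t (Γ a t)) (Icc t₁ T) := fun t ht =>
      ContinuousAt.comp_continuousWithinAt (f := fun r => (r, Γ a r))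
        (h.du t (ht₁.trans_le ht.1) (Γ a t)).continuousAt
        ((continuousOn_id.prodMk hcont) t ht)
    have hmono : ∀ τ ∈ Icc t₁ T, (∀ t ∈ Ico t₁ τ, u t (Γ a t) < η) →
        ζ ≤ √(speed s α (u τ (Γ a τ))) * riemX s α u ux vx τ (Γ a τ) := by
      intro τ hτ hlt
      have := h.monotoneOn_lax hs ht₁ (γ := Γ a) (τ := τ)
        (hcont.mono (Icc_subset_Icc_right hτ.2)) (fun t ht => by
          have h1 := hlt t ⟨ht.1.le, ht.2⟩
          refine ⟨h1.trans hη2, ?_⟩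
          have h2 := (hder t ⟨ht.1.le, ht.2.le.trans hτ.2⟩).hasDerivAt
            (Icc_mem_nhds ht.1 (ht.2.trans_le hτ.2))
          rwa [min_eq_left h1.le] at h2)
        (left_mem_Icc.2 hτ.1) (right_mem_Icc.2 hτ.1) hτ.1
      simp only [hinit] at this
      exact (hmin ha').trans this
    have hlt : ∀ t ∈ Icc t₁ T, u t (Γ a t) < η := by
      by_contra! hcon
      obtain ⟨t, ht, hte⟩ := hcon
      have hcomp : IsCompact (Icc t₁ T ∩ (fun t => u t (Γ a t)) ⁻¹' Ici η) :=
        isCompact_Icc.of_isClosed_subset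
          (hgcont.preimage_isClosed_of_isClosed isClosed_Icc isClosed_Ici) inter_subset_left
      obtain ⟨τ, ⟨hτ, hτe⟩, hτmin⟩ := hcomp.exists_isLeast ⟨t, ht, hte⟩
      have hbefore : ∀ r ∈ Ico t₁ τ, u r (Γ a r) < η := by
        intro r hr
        by_contra! hge
        exact (hτmin ⟨⟨hr.1, hr.2.le.trans hτ.2⟩, hge⟩).not_gt hr.2
      have h1 := hmono τ hτ hbefore
      have h2 : √(speed s α (u τ (Γ a τ))) ≤ √(speed s α η) :=
        Real.sqrt_le_sqrt (hs.speed_antitone hτe)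
      have h3 := (abs_le.1 (hM τ hτ (Γ a τ))).2
      have h4 : √(speed s α (u τ (Γ a τ))) * riemX s α u ux vx τ (Γ a τ) ≤ √(speed s α η) * M :=
        (mul_le_mul_of_nonneg_left h3 (Real.sqrt_nonneg _)).trans
          (mul_le_mul_of_nonneg_right h2 hM0.le)
      linarith
    intro t ht
    refine ⟨hlt t ht, ?_⟩
    have h1 := hmono t ht fun r hr => hlt r ⟨hr.1, hr.2.le.trans ht.2⟩
    exact pos_of_mul_pos_right (hζ0.trans_le h1) (Real.sqrt_nonneg _)
  have hder : ∀ a ∈ Icc a₁ a₂, ∀ t ∈ Icc t₁ T,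
      HasDerivWithinAt (Γ a) (speed s α (u t (Γ a t))) (Icc t₁ T) t := by
    intro a ha' t ht
    have := (hΓ a (hball ha')).2 t ht
    rwa [min_eq_left (main a ha' t ht).1.le] at this
  have m1 := left_mem_Icc.2 ha
  have m2 := right_mem_Icc.2 ha
  refine ⟨Γ a₁, Γ a₂, (hΓ a₁ (hball m1)).1, (hΓ a₂ (hball m2)).1, hder a₁ m1, hder a₂ m2,
    fun t ht x hx => ?_⟩
  -- The flow is continuous in the starting point, so by the intermediate value theorem every point
  -- between the outer curves lies on a curve already controlled.
  have hc : ContinuousOn (fun a => Γ a t) (uIcc a₁ a₂) := by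
    rw [uIcc_of_le ha]; exact ((hL' t ht).mono hball).continuousOn
  obtain ⟨a, ha', rfl⟩ := intermediate_value_uIcc hc hx
  rw [uIcc_of_le ha] at ha'
  exact ⟨(main a ha' t ht).1.trans hη2, (main a ha' t ht).2⟩

end PSol

namespace IsStrip

variable {s s' : ℝ → ℝ} {α β t₀ t₁ T a₁ a₂ : ℝ} {u v ux vx uxx vxx : ℝ → ℝ → ℝ} {γ₁ γ₂ : ℝ → ℝ}

theorem riem_eq_of_deriv (h : PSol s s' t₀ u v ux vx uxx vxx) (hs : SonicData s s' α β)
    (ht₁ : t₀ < t₁) {γ : ℝ → ℝ}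
    (hγ : ∀ t ∈ Icc t₁ T, HasDerivWithinAt γ (speed s α (u t (γ t))) (Icc t₁ T) t)
    (hu : ∀ t ∈ Icc t₁ T, u t (γ t) < α) {t : ℝ} (ht : t ∈ Icc t₁ T) :
    riem s α u v t (γ t) = riem s α u v t₁ (γ t₁) := by
  have hT : t₁ ≤ T := ht.1.trans ht.2
  have hc : ContinuousOn (fun r => riem s α u v r (γ r)) (Icc t₁ T) := fun r hr =>
    ContinuousAt.comp_continuousWithinAt (f := fun r => (r, γ r))
      (h.hasFDerivAt_riem hs (ht₁.trans_le hr.1) (γ r)).continuousAt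
      (continuousWithinAt_id.prodMk (hγ r hr).continuousWithinAt)
  have hd : ∀ r ∈ interior (Icc t₁ T), HasDerivAt (fun r => riem s α u v r (γ r)) 0 r := by
    intro r hr
    rw [interior_Icc] at hr
    have hr' := Ioo_subset_Icc_self hr
    exact h.hasDerivAt_riem_along hs (ht₁.trans hr.1) (hu r hr').le
      ((hγ r hr').hasDerivAt (Icc_mem_nhds hr.1 hr.2))
  have hm := monotoneOn_of_deriv_nonneg (convex_Icc _ _) hc
    (fun r hr => (hd r hr).differentiableAt.differentiableWithinAt) (fun r hr => (hd r hr).deriv.ge)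
  have ha := antitoneOn_of_deriv_nonpos (convex_Icc _ _) hc
    (fun r hr => (hd r hr).differentiableAt.differentiableWithinAt) (fun r hr => (hd r hr).deriv.le)
  exact le_antisymm (ha (left_mem_Icc.2 hT) ht ht.1) (hm (left_mem_Icc.2 hT) ht ht.1)

theorem riem₁ (hS : IsStrip s α u ux vx t₁ T a₁ a₂ γ₁ γ₂) (h : PSol s s' t₀ u v ux vx uxx vxx)
    (hs : SonicData s s' α β) (ht₁ : t₀ < t₁) {t : ℝ} (ht : t ∈ Icc t₁ T) :
    riem s α u v t (γ₁ t) = riem s α u v t₁ a₁ := by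
  rw [riem_eq_of_deriv h hs ht₁ hS.deriv₁ (fun r hr => (hS.hyp r hr _ left_mem_uIcc).1) ht, hS.init₁]

theorem riem₂ (hS : IsStrip s α u ux vx t₁ T a₁ a₂ γ₁ γ₂) (h : PSol s s' t₀ u v ux vx uxx vxx)
    (hs : SonicData s s' α β) (ht₁ : t₀ < t₁) {t : ℝ} (ht : t ∈ Icc t₁ T) :
    riem s α u v t (γ₂ t) = riem s α u v t₁ a₂ := by
  rw [riem_eq_of_deriv h hs ht₁ hS.deriv₂ (fun r hr => (hS.hyp r hr _ right_mem_uIcc).1) ht,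
    hS.init₂]

theorem strictMonoOn (hS : IsStrip s α u ux vx t₁ T a₁ a₂ γ₁ γ₂)
    (h : PSol s s' t₀ u v ux vx uxx vxx) (hs : SonicData s s' α β) (ht₁ : t₀ < t₁) {t : ℝ}
    (ht : t ∈ Icc t₁ T) : StrictMonoOn (riem s α u v t) (uIcc (γ₁ t) (γ₂ t)) := by
  have hd := fun x => (h.hasFDerivAt_riem hs (ht₁.trans_le ht.1) x).snd_deriv
  refine strictMonoOn_of_deriv_pos (convex_uIcc _ _)
    (fun x _ => (hd x).continuousAt.continuousWithinAt) fun x hx => ?_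
  rw [(hd x).deriv]
  exact (hS.hyp t ht x (interior_subset hx)).2

theorem riem_lt (hS : IsStrip s α u ux vx t₁ T a₁ a₂ γ₁ γ₂)
    (h : PSol s s' t₀ u v ux vx uxx vxx) (hs : SonicData s s' α β) (ht₁ : t₀ < t₁) (hT : t₁ ≤ T)
    (ha : a₁ < a₂) : riem s α u v t₁ a₁ < riem s α u v t₁ a₂ := by
  have := hS.strictMonoOn h hs ht₁ (left_mem_Icc.2 hT)
  rw [hS.init₁, hS.init₂] at this
  exact this left_mem_uIcc right_mem_uIcc ha

/-- Order is read off from r, which is strictly increasing across the strip and keeps the values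
r(a₁) < r(a₂) on the sides. Until this is known, the strip has to be described by `uIcc`. -/
theorem lt (hS : IsStrip s α u ux vx t₁ T a₁ a₂ γ₁ γ₂)
    (h : PSol s s' t₀ u v ux vx uxx vxx) (hs : SonicData s s' α β) (ht₁ : t₀ < t₁)
    (ha : a₁ < a₂) {t : ℝ} (ht : t ∈ Icc t₁ T) : γ₁ t < γ₂ t := by
  have h1 := hS.riem_lt h hs ht₁ (ht.1.trans ht.2) ha
  rw [← hS.riem₁ h hs ht₁ ht, ← hS.riem₂ h hs ht₁ ht] at h1
  exact ((hS.strictMonoOn h hs ht₁ ht).lt_iff_lt left_mem_uIcc right_mem_uIcc).1 h1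

/-- By periodicity a strip is narrower than one period. -/
theorem width_le (hS : IsStrip s α u ux vx t₁ T a₁ a₂ γ₁ γ₂)
    (h : PSol s s' t₀ u v ux vx uxx vxx) (hs : SonicData s s' α β) (ht₁ : t₀ < t₁)
    (ha : a₁ < a₂) {t : ℝ} (ht : t ∈ Icc t₁ T) : γ₂ t ≤ γ₁ t + 1 := by
  by_contra! hlt
  have hle := (hS.lt h hs ht₁ ha ht).le
  have := hS.strictMonoOn h hs ht₁ ht left_mem_uIcc (b := γ₁ t + 1)
    (by rw [uIcc_of_le hle]; exact ⟨by linarith, hlt.le⟩) (by linarith)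
  rw [h.periodic_riem (ht₁.trans_le ht.1)] at this
  exact lt_irrefl _ this

theorem monotoneOn_of_deriv {γ : ℝ → ℝ}
    (hγ : ∀ t ∈ Icc t₁ T, HasDerivWithinAt γ (speed s α (u t (γ t))) (Icc t₁ T) t) :
    MonotoneOn γ (Icc t₁ T) := by
  refine monotoneOn_of_deriv_nonneg (convex_Icc _ _) (fun t ht => (hγ t ht).continuousWithinAt)
    (fun t ht => ?_) (fun t ht => ?_) <;> rw [interior_Icc] at ht <;>
    have hd := (hγ t (Ioo_subset_Icc_self ht)).hasDerivAt (Icc_mem_nhds ht.1 ht.2)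
  · exact hd.differentiableAt.differentiableWithinAt
  · rw [hd.deriv]; exact SonicData.speed_nonneg _

/-! ### Balance laws on strips and unbounded displacement -/

/-- Decay of the integral over a strip of `G(u) + l r`, where `r` is the Riemann invariant. -/
theorem balance (hS : IsStrip s α u ux vx t₁ T a₁ a₂ γ₁ γ₂)
    (h : PSol s s' t₀ u v ux vx uxx vxx) (hs : SonicData s s' α β) (ht₁ : t₀ < t₁) (hT : t₁ ≤ T)
    (ha : a₁ < a₂) {G P g : ℝ → ℝ} {l κ N : ℝ}
    (hG : ∀ w < α, HasDerivAt G (g w) w) (hP : ∀ w < α, HasDerivAt P (speed s α w * g w) w)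
    (hg : ContinuousOn g (Iio α))
    (hκ : ∀ t ∈ Ioo t₁ T, ∀ x ∈ Icc (γ₁ t) (γ₂ t), κ ≤ g (u t x) + l * speed s α (u t x))
    (hflux : ∀ t ∈ Ioo t₁ T,
      (P (u t (γ₂ t)) + (G (u t (γ₂ t)) + l * riem s α u v t₁ a₂) * speed s α (u t (γ₂ t))) -
      (P (u t (γ₁ t)) + (G (u t (γ₁ t)) + l * riem s α u v t₁ a₁) * speed s α (u t (γ₁ t))) ≤
        κ * (riem s α u v t₁ a₂ - riem s α u v t₁ a₁) / 2 +
          N * (speed s α (u t (γ₁ t)) + speed s α (u t (γ₂ t)))) :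
    ∫ x in (γ₁ T)..(γ₂ T), (G (u T x) + l * riem s α u v T x) ≤
      (∫ x in a₁..a₂, (G (u t₁ x) + l * riem s α u v t₁ x)) -
        κ * (riem s α u v t₁ a₂ - riem s α u v t₁ a₁) / 2 * (T - t₁) +
          N * ((γ₁ T - a₁) + (γ₂ T - a₂)) := by
  set δ := riem s α u v t₁ a₂ - riem s α u v t₁ a₁ with hδ
  have c₁ : ContinuousOn γ₁ (Icc t₁ T) := fun t ht => (hS.deriv₁ t ht).continuousWithinAt
  have c₂ : ContinuousOn γ₂ (Icc t₁ T) := fun t ht => (hS.deriv₂ t ht).continuousWithinAt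
  have hle : ∀ t ∈ Icc t₁ T, γ₁ t ≤ γ₂ t := fun t ht => (hS.lt h hs ht₁ ha ht).le
  have hyp : ∀ t ∈ Icc t₁ T, ∀ x ∈ Icc (γ₁ t) (γ₂ t), u t x < α ∧ 0 < riemX s α u ux vx t x := by
    intro t ht x hx
    rw [← uIcc_of_le (hle t ht)] at hx
    exact hS.hyp t ht x hx
  have hE : ∀ t ∈ Icc t₁ T, ∀ x ∈ Icc (γ₁ t) (γ₂ t),
      HasFDerivAt (fun p : ℝ × ℝ => G (u p.1 p.2) + l * riem s α u v p.1 p.2)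
        (pairing (g (u t x) * -vx t x + l * (-speed s α (u t x) * riemX s α u ux vx t x))
          (g (u t x) * ux t x + l * riemX s α u ux vx t x)) (t, x) := by
    intro t ht x hx
    have ht0 := ht₁.trans_le ht.1
    have h1 := HasDerivAt.comp_pairing (f := fun p : ℝ × ℝ => u p.1 p.2) (p := (t, x))
      (hG (u t x) (hyp t ht x hx).1) (h.du t ht0 x)
    have h2 := HasDerivAt.comp_pairing (h := fun y => l * y)
      (f := fun p : ℝ × ℝ => riem s α u v p.1 p.2) (p := (t, x))
      (h' := l) (by simpa using (hasDerivAt_id (riem s α u v t x)).const_mul l)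
      (h.hasFDerivAt_riem hs ht0 x)
    rw [PSol.riem_transport hs (hyp t ht x hx).1.le] at h2
    exact h1.pairing_add h2
  have hsubI : Ioo t₁ T ⊆ Icc t₁ T := Ioo_subset_Icc_self
  have hd₁ : ∀ t ∈ Ioo t₁ T, HasDerivAt γ₁ (speed s α (u t (γ₁ t))) t := fun t ht =>
    (hS.deriv₁ t (hsubI ht)).hasDerivAt (Icc_mem_nhds ht.1 ht.2)
  have hd₂ : ∀ t ∈ Ioo t₁ T, HasDerivAt γ₂ (speed s α (u t (γ₂ t))) t := fun t ht =>
    (hS.deriv₂ t (hsubI ht)).hasDerivAt (Icc_mem_nhds ht.1 ht.2)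
  have csp : ∀ {γ : ℝ → ℝ}, ContinuousOn γ (Icc t₁ T) →
      ContinuousOn (fun t => speed s α (u t (γ t))) (Ioo t₁ T) := by
    intro γ hγ t ht
    exact hs.speed_continuous.continuousAt.comp_continuousWithinAt
      (ContinuousAt.comp_continuousWithinAt (f := fun r => (r, γ r))
        (h.du t (ht₁.trans ht.1) (γ t)).continuousAt
        ((continuousOn_id.prodMk (hγ.mono hsubI)) t ht))
  have hcu : ∀ t x, t₀ < t → ContinuousAt (fun p : ℝ × ℝ => u p.1 p.2) (t, x) := fun t x ht =>
    (h.du t ht x).continuousAt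
  have hcg : ∀ t ∈ Icc t₁ T, ∀ x ∈ Icc (γ₁ t) (γ₂ t),
      ContinuousAt (fun p : ℝ × ℝ => g (u p.1 p.2)) (t, x) := fun t ht x hx =>
    ContinuousAt.comp (f := fun p : ℝ × ℝ => u p.1 p.2)
      (hg.continuousAt (Iio_mem_nhds (hyp t ht x hx).1)) (hcu t x (ht₁.trans_le ht.1))
  have hcs : ∀ t x, t₀ < t → ContinuousAt (fun p : ℝ × ℝ => speed s α (u p.1 p.2)) (t, x) :=
    fun t x ht => hs.speed_continuous.continuousAt.comp (hcu t x ht)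
  have hder : ∀ t ∈ Ioo t₁ T, HasDerivAt
      (fun t => ∫ x in (γ₁ t)..(γ₂ t), (G (u t x) + l * riem s α u v t x))
      ((∫ x in (γ₁ t)..(γ₂ t),
        (g (u t x) * -vx t x + l * (-speed s α (u t x) * riemX s α u ux vx t x))) +
        ((G (u t (γ₂ t)) + l * riem s α u v t (γ₂ t)) * speed s α (u t (γ₂ t)) -
          (G (u t (γ₁ t)) + l * riem s α u v t (γ₁ t)) * speed s α (u t (γ₁ t)))) t := by
    intro t ht
    refine hasDerivAt_integral_between (E := fun t x => G (u t x) + l * riem s α u v t x)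
      (Et := fun t x => g (u t x) * -vx t x + l * (-speed s α (u t x) * riemX s α u ux vx t x))
      (Ex := fun t x => g (u t x) * ux t x + l * riemX s α u ux vx t x)
      (L' := fun t => speed s α (u t (γ₁ t))) (R' := fun t => speed s α (u t (γ₂ t)))
      ht hd₁ hd₂ (csp c₁) (csp c₂) (fun r hr => hle r (hsubI hr))
      (fun p hp => hE p.1 (hsubI hp.1) p.2 hp.2) ?_ ?_
    · rintro ⟨t, x⟩ ⟨ht, hx⟩
      have ht0 : t₀ < t := ht₁.trans ht.1
      refine ContinuousAt.continuousWithinAt ?_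
      exact ((hcg t (hsubI ht) x hx).mul (h.dvx t ht0 x).continuousAt.neg).add
        (continuousAt_const.mul ((hcs t x ht0).neg.mul (h.continuousAt_riemX hs ht0 x)))
    · rintro ⟨t, x⟩ ⟨ht, hx⟩
      have ht0 : t₀ < t := ht₁.trans ht.1
      refine ContinuousAt.continuousWithinAt ?_
      exact ((hcg t (hsubI ht) x hx).mul (h.dux t ht0 x).continuousAt).add
        (continuousAt_const.mul (h.continuousAt_riemX hs ht0 x))
  have hcontK : ContinuousOn
      (fun t => ∫ x in (γ₁ t)..(γ₂ t), (G (u t x) + l * riem s α u v t x)) (Icc t₁ T) :=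
    continuousOn_integral_between (E := fun t x => G (u t x) + l * riem s α u v t x) hT c₁ c₂ hle
      fun p hp => (hE p.1 hp.1 p.2 hp.2).continuousAt.continuousWithinAt
  -- Since v_x = r_x - c u_x, the integrand is -(g + l c) r_x plus the x-derivative of P(u). Here
  -- r_x > 0, its coefficient is at most -κ, and r_x integrates to δ.
  have hineq : ∀ t ∈ Ioo t₁ T,
      (∫ x in (γ₁ t)..(γ₂ t),
        (g (u t x) * -vx t x + l * (-speed s α (u t x) * riemX s α u ux vx t x))) ≤
      -κ * δ + (P (u t (γ₂ t)) - P (u t (γ₁ t))) := by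
    intro t ht
    have ht0 : t₀ < t := ht₁.trans ht.1
    have hslice : ∀ {f : ℝ → ℝ → ℝ}, (∀ x ∈ Icc (γ₁ t) (γ₂ t),
        ContinuousAt (fun p : ℝ × ℝ => f p.1 p.2) (t, x)) →
        IntervalIntegrable (f t) volume (γ₁ t) (γ₂ t) := by
      intro f hf
      refine ContinuousOn.intervalIntegrable fun x hx => ?_
      rw [uIcc_of_le (hle t (hsubI ht))] at hx
      exact (ContinuousAt.comp (f := fun x => (t, x)) (hf x hx) (by fun_prop)).continuousWithinAt
    have i1 := hslice (f := riemX s α u ux vx) fun x _ => h.continuousAt_riemX hs ht0 x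
    have i2 := hslice (f := fun t x => speed s α (u t x) * g (u t x) * ux t x) fun x hx =>
      ((hcs t x ht0).mul (hcg t (hsubI ht) x hx)).mul (h.dux t ht0 x).continuousAt
    have i3 := hslice (f := fun t x =>
      g (u t x) * -vx t x + l * (-speed s α (u t x) * riemX s α u ux vx t x)) fun x hx =>
        ((hcg t (hsubI ht) x hx).mul (h.dvx t ht0 x).continuousAt.neg).add
        (continuousAt_const.mul ((hcs t x ht0).neg.mul (h.continuousAt_riemX hs ht0 x)))
    have e1 : ∫ x in (γ₁ t)..(γ₂ t), riemX s α u ux vx t x = δ := by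
      rw [intervalIntegral.integral_eq_sub_of_hasDerivAt
        (fun x _ => (h.hasFDerivAt_riem hs ht0 x).snd_deriv) i1, hS.riem₁ h hs ht₁ (hsubI ht),
        hS.riem₂ h hs ht₁ (hsubI ht)]
    have e2 : ∫ x in (γ₁ t)..(γ₂ t), speed s α (u t x) * g (u t x) * ux t x =
        P (u t (γ₂ t)) - P (u t (γ₁ t)) := by
      refine intervalIntegral.integral_eq_sub_of_hasDerivAt (f := fun x => P (u t x))
        (fun x hx => ?_) i2
      exact (hP (u t x) (hS.hyp t (hsubI ht) x hx).1).comp x (h.du t ht0 x).snd_deriv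
    rw [← e1, ← e2, ← intervalIntegral.integral_const_mul,
      ← intervalIntegral.integral_add (i1.const_mul _) i2]
    refine intervalIntegral.integral_mono_on (hle t (hsubI ht)) i3 ((i1.const_mul _).add i2)
      fun x hx => ?_
    have h1 := hκ t ht x hx
    have h2 := (hyp t (hsubI ht) x hx).2
    have h3 : vx t x = riemX s α u ux vx t x - speed s α (u t x) * ux t x := by
      rw [riemX]; ring
    rw [h3]
    nlinarith [mul_le_mul_of_nonneg_right h1 h2.le]
  -- the compensated functional is decreasing
  have hanti : AntitoneOn (fun t => (∫ x in (γ₁ t)..(γ₂ t), (G (u t x) + l * riem s α u v t x)) +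
      κ * δ / 2 * t - N * (γ₁ t + γ₂ t)) (Icc t₁ T) := by
    have hd : ∀ t ∈ Ioo t₁ T, HasDerivAt _ _ t := fun t ht =>
      ((hder t ht).add ((hasDerivAt_id t).const_mul (κ * δ / 2))).sub
        (((hd₁ t ht).add (hd₂ t ht)).const_mul N)
    refine antitoneOn_of_deriv_nonpos (convex_Icc _ _)
      ((hcontK.add (by fun_prop)).sub (continuousOn_const.mul (c₁.add c₂))) ?_ ?_
    · intro t ht
      rw [interior_Icc] at ht
      exact (hd t ht).differentiableAt.differentiableWithinAt
    · intro t ht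
      rw [interior_Icc] at ht
      refine (hd t ht).deriv.trans_le ?_
      have h1 := hineq t ht
      have h2 := hflux t ht
      rw [hS.riem₁ h hs ht₁ (hsubI ht), hS.riem₂ h hs ht₁ (hsubI ht)]
      linarith
  have := hanti (left_mem_Icc.2 hT) (right_mem_Icc.2 hT) hT
  simp only [hS.init₁, hS.init₂] at this
  linarith

/-- Characteristics bounding a strip travel arbitrarily far. -/
theorem exists_far (h : PSol s s' t₀ u v ux vx uxx vxx) (hs : SonicData s s' α β) (ht₁ : t₀ < t₁)
    (ha : a₁ < a₂) (X : ℝ) :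
    ∃ T₀, t₁ ≤ T₀ ∧ ∀ T ≥ T₀, ∀ γ₁ γ₂, IsStrip s α u ux vx t₁ T a₁ a₂ γ₁ γ₂ → X < γ₁ T := by
  set r₁ := riem s α u v t₁ a₁ with hr₁
  set r₂ := riem s α u v t₁ a₂ with hr₂
  by_cases hδ : r₁ < r₂
  swap
  · exact ⟨t₁, le_rfl, fun T hT γ₁ γ₂ hS => (hδ (hS.riem_lt h hs ht₁ hT ha)).elim⟩
  -- κ bounds exp(u - α) + c(u) from below on all of u < α: the exponential serves for u ≥ α - 1,
  -- the speed for u < α - 1. Adding r to the entropy thus removes any need for a lower bound on u.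
  set κ := min (Real.exp (-1)) (speed s α (α - 1)) with hκ
  have hκ0 : 0 < κ := lt_min (Real.exp_pos _) (hs.speed_pos (by linarith))
  -- N dominates the boundary flux: at each side 0 < G ≤ 1, -c ≤ P ≤ 0, and r is r₁ or r₂.
  set N := 1 + |r₁| + |r₂| with hN
  have hN0 : 0 < N := by positivity
  set K₀ := ∫ x in a₁..a₂, (Real.exp (u t₁ x - α) + 1 * riem s α u v t₁ x) with hK₀
  set d := κ * (r₂ - r₁) / 2 with hd
  have hd0 : 0 < d := by have := sub_pos.2 hδ; positivity
  -- The integral at time T is at least -|r₁|. If γ₁ T ≤ X, then γ₂ T ≤ X + 1 and the total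
  -- displacement is at most 2X + 1 - a₁ - a₂, so the balance gives d(T - t₁) < Y.
  set Y := |K₀ + |r₁| + N * (2 * X + 1 - a₁ - a₂)| + 1 with hY
  refine ⟨t₁ + Y / d, by have : 0 < Y := by positivity
                         have : 0 < Y / d := by positivity
                         linarith, fun T hT γ₁ γ₂ hS => ?_⟩
  by_contra! hX
  have hT1 : Y ≤ d * (T - t₁) := by
    rw [ge_iff_le, ← le_sub_iff_add_le', div_le_iff₀ hd0] at hT
    linarith
  have hT' : t₁ ≤ T := by
    have : 0 < Y := by positivity
    nlinarith
  have hTm := right_mem_Icc.2 hT'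
  have hexp : Continuous fun w => speed s α w * Real.exp (w - α) :=
    hs.speed_continuous.mul (by fun_prop)
  have hPlo : ∀ w ≤ α, -speed s α w ≤ ∫ y in α..w, speed s α y * Real.exp (y - α) := by
    intro w hw
    rw [intervalIntegral.integral_symm, neg_le_neg_iff]
    calc ∫ y in w..α, speed s α y * Real.exp (y - α)
        ≤ ∫ y in w..α, speed s α w * Real.exp (y - α) := by
          refine intervalIntegral.integral_mono_on hw (hexp.intervalIntegrable _ _)
            (Continuous.intervalIntegrable (by fun_prop) _ _) fun y hy => ?_
          exact mul_le_mul_of_nonneg_right (hs.speed_antitone hy.1) (Real.exp_pos _).le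
      _ = speed s α w * (1 - Real.exp (w - α)) := by
          rw [intervalIntegral.integral_const_mul,
            intervalIntegral.integral_comp_sub_right (fun y => Real.exp y) α]
          simp
      _ ≤ speed s α w := by
          have := SonicData.speed_nonneg (s := s) (α := α) w
          nlinarith [Real.exp_pos (w - α)]
  have hPhi : ∀ w ≤ α, ∫ y in α..w, speed s α y * Real.exp (y - α) ≤ 0 := by
    intro w hw
    rw [intervalIntegral.integral_symm]
    exact neg_nonpos.2 (intervalIntegral.integral_nonneg hw fun y _ =>
      mul_nonneg (SonicData.speed_nonneg _) (Real.exp_pos _).le)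
  have key := hS.balance h hs ht₁ hT' ha (G := fun w => Real.exp (w - α))
    (g := fun w => Real.exp (w - α)) (P := fun w => ∫ y in α..w, speed s α y * Real.exp (y - α))
    (l := 1) (κ := κ) (N := N)
    (fun w _ => by simpa using ((hasDerivAt_id w).sub_const α).exp)
    (fun w _ => intervalIntegral.integral_hasDerivAt_right (hexp.intervalIntegrable _ _)
      (hexp.stronglyMeasurableAtFilter _ _) hexp.continuousAt)
    (by fun_prop)
    (fun t ht x hx => by
      rcases le_or_gt (α - 1) (u t x) with h1 | h1
      · have h2 : Real.exp (-1) ≤ Real.exp (u t x - α) := Real.exp_le_exp.2 (by linarith)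
        have h3 := SonicData.speed_nonneg (s := s) (α := α) (u t x)
        have h4 : κ ≤ Real.exp (-1) := min_le_left _ _
        linarith
      · have h2 := hs.speed_antitone h1.le
        have h3 := Real.exp_pos (u t x - α)
        have h4 : κ ≤ speed s α (α - 1) := min_le_right _ _
        linarith)
    (fun t ht => by
      have ht' := Ioo_subset_Icc_self ht
      have u₁ := (hS.hyp t ht' _ left_mem_uIcc).1
      have u₂ := (hS.hyp t ht' _ right_mem_uIcc).1
      have p₁ := hPlo _ u₁.le
      have p₂ := hPhi _ u₂.le
      have s₁ := SonicData.speed_nonneg (s := s) (α := α) (u t (γ₁ t))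
      have s₂ := SonicData.speed_nonneg (s := s) (α := α) (u t (γ₂ t))
      have e₁ := Real.exp_pos (u t (γ₁ t) - α)
      have e₂ : Real.exp (u t (γ₂ t) - α) ≤ 1 := Real.exp_le_one_iff.2 (by linarith)
      have q₁ : -((Real.exp (u t (γ₁ t) - α) + 1 * r₁) * speed s α (u t (γ₁ t))) ≤
          |r₁| * speed s α (u t (γ₁ t)) := by
        rw [← neg_mul]
        exact mul_le_mul_of_nonneg_right (by linarith [neg_abs_le r₁]) s₁
      have q₂ : (Real.exp (u t (γ₂ t) - α) + 1 * r₂) * speed s α (u t (γ₂ t)) ≤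
          (1 + |r₂|) * speed s α (u t (γ₂ t)) :=
        mul_le_mul_of_nonneg_right (by linarith [le_abs_self r₂]) s₂
      have n₁ : (1 + |r₁|) * speed s α (u t (γ₁ t)) ≤ N * speed s α (u t (γ₁ t)) :=
        mul_le_mul_of_nonneg_right (by linarith [abs_nonneg r₂]) s₁
      have n₂ : (1 + |r₂|) * speed s α (u t (γ₂ t)) ≤ N * speed s α (u t (γ₂ t)) :=
        mul_le_mul_of_nonneg_right (by linarith [abs_nonneg r₁]) s₂
      linarith)
  have hlt := hS.lt h hs ht₁ ha hTm
  have hwid := hS.width_le h hs ht₁ ha hTm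
  have hlow : -|r₁| ≤
      ∫ x in (γ₁ T)..(γ₂ T), (Real.exp (u T x - α) + 1 * riem s α u v T x) := by
    have hT0 := ht₁.trans_le hT'
    have hcr : Continuous (riem s α u v T) := continuous_iff_continuousAt.2 fun x =>
      (h.hasFDerivAt_riem hs hT0 x).snd_deriv.continuousAt
    have hcu := h.continuous_u hT0
    calc -|r₁| ≤ ∫ x in (γ₁ T)..(γ₂ T), -|r₁| := by
          rw [intervalIntegral.integral_const, smul_eq_mul]
          nlinarith [abs_nonneg r₁]
      _ ≤ _ := by
          refine intervalIntegral.integral_mono_on hlt.le (by simp)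
            (Continuous.intervalIntegrable (by fun_prop) _ _) fun x hx => ?_
          have := (hS.strictMonoOn h hs ht₁ hTm).monotoneOn left_mem_uIcc
            (by rwa [uIcc_of_le hlt.le] : x ∈ _) hx.1
          rw [hS.riem₁ h hs ht₁ hTm] at this
          linarith [neg_abs_le r₁, Real.exp_pos (u T x - α)]
  have hNX : N * ((γ₁ T - a₁) + (γ₂ T - a₂)) ≤ N * (2 * X + 1 - a₁ - a₂) :=
    mul_le_mul_of_nonneg_left (by linarith) hN0.le
  have := le_abs_self (K₀ + |r₁| + N * (2 * X + 1 - a₁ - a₂))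
  simp only [← hr₁, ← hr₂, ← hd, ← hK₀] at key
  linarith

end IsStrip

/-! ### Entropies with small flux oscillation and the life span of strips -/

namespace SonicData

variable {s s' : ℝ → ℝ} {α β : ℝ}

/-- The state is uniformly approximated by polynomials in the speed. -/
theorem exists_polynomial_near (h : SonicData s s' α β) (m : ℝ) {ε : ℝ} (hε : 0 < ε) :
    ∃ p : Polynomial ℝ, ∀ w ∈ Icc m α, |w - p.eval (speed s α w)| < ε := by
  set c : C(Icc m α, ℝ) := ⟨fun w => speed s α w, h.speed_continuous.comp continuous_subtype_val⟩
  -- The speed is strictly decreasing on [m, α], so it alone separates points and Stone–Weierstrass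
  -- applies to polynomials in it.
  have hsep : (Algebra.adjoin ℝ {c}).SeparatesPoints := by
    intro x y hxy
    refine ⟨c, ⟨c, Algebra.subset_adjoin rfl, rfl⟩, fun heq => hxy ?_⟩
    exact Subtype.ext (h.speed_strictAntiOn.injOn x.2.2 y.2.2 heq)
  obtain ⟨⟨f, hf⟩, hfε⟩ :=
    ContinuousMap.exists_mem_subalgebra_near_continuousMap_of_separatesPoints
    (Algebra.adjoin ℝ {c}) hsep ⟨fun w : Icc m α => (w : ℝ), continuous_subtype_val⟩ ε hε
  rw [Algebra.adjoin_singleton_eq_range_aeval] at hf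
  obtain ⟨p, rfl⟩ := hf
  refine ⟨p, fun w hw => ?_⟩
  have h1 := (ContinuousMap.norm_lt_iff _ hε).1 hfε ⟨w, hw⟩
  have h2 : (Polynomial.aeval c p : C(Icc m α, ℝ)) ⟨w, hw⟩ = p.eval (speed s α w) := by
    have := Polynomial.aeval_algHom_apply
      (ContinuousMap.evalAlgHom ℝ ℝ (⟨w, hw⟩ : Icc m α)) c p
    rw [ContinuousMap.evalAlgHom_apply] at this
    rw [← Polynomial.coe_aeval_eq_eval]
    exact this.symm
  simp only [ContinuousMap.sub_apply, ContinuousMap.coe_mk, Real.norm_eq_abs] at h1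
  rw [abs_sub_comm, ← h2]
  exact h1

/-- An entropy `G`, bounded below, growing at least linearly, whose flux along characteristics
oscillates arbitrarily little. -/
theorem exists_entropy (h : SonicData s s' α β) {m : ℝ} (hm : m < α) {d : ℝ} (hd : 0 < d) :
    ∃ (G P g : ℝ → ℝ) (b : ℝ), (∀ w < α, HasDerivAt G (g w) w) ∧
      (∀ w < α, HasDerivAt P (speed s α w * g w) w) ∧ ContinuousOn g (Iio α) ∧
      (∀ w ∈ Ico m α, 1 ≤ g w) ∧ (∀ w ∈ Ico m α, b ≤ G w) ∧
      ∀ w ∈ Ico m α, ∀ z ∈ Ico m α,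
        (P w + G w * speed s α w) - (P z + G z * speed s α z) ≤ d := by
  set cm := speed s α m with hcm
  have hcm0 : 0 < cm := h.speed_pos hm
  -- The flux will be H + 2c(w - p(c)): H oscillates by at most ε cm and the second term by at most
  -- 4 ε cm.
  set ε := d / (5 * cm) with hε
  have hε0 : 0 < ε := by positivity
  have hεcm : 5 * cm * ε = d := by rw [hε]; field_simp
  obtain ⟨p, hp⟩ := h.exists_polynomial_near m hε0
  obtain ⟨B, hB⟩ := isCompact_Icc.exists_bound_of_continuousOn
    (Polynomial.continuous p.derivative).continuousOn (s := Icc 0 cm)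
  have hB0 : 0 ≤ B := (norm_nonneg _).trans (hB 0 ⟨le_rfl, hcm0.le⟩)
  -- Just large enough that Λ s'/(4c²√c) ≥ B s'/(2c) whenever c ≤ cm.
  set Λ := 2 * B * (cm * √cm) with hΛ
  have hΛ0 : 0 ≤ Λ := by positivity
  set q : ℝ → ℝ := fun y => ∫ x in (0 : ℝ)..y, x * p.derivative.eval x with hq
  have hqc : Continuous fun x => x * p.derivative.eval x :=
    continuous_id.mul (Polynomial.continuous _)
  have hqd : ∀ y, HasDerivAt q (y * p.derivative.eval y) y := fun y =>
    intervalIntegral.integral_hasDerivAt_right (hqc.intervalIntegrable _ _)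
      (hqc.stronglyMeasurableAtFilter _ _) hqc.continuousAt
  set c := speed s α with hc
  have hc' : ∀ w < α, HasDerivAt c (-s' w / (2 * c w)) w := fun w hw => h.hasDerivAt_speed hw
  have hcpos : ∀ w < α, 0 < c w := fun w hw => h.speed_pos hw
  have hcle : ∀ w, m ≤ w → c w ≤ cm := fun w hw => h.speed_antitone hw
  -- Derivative of G = Λ/√c + (w - p(c)). The first summand solves (P + Gc)' = 0 with P = -Λ√c, so
  -- it has no flux, but its derivative vanishes with s'. The second supplies the missing 1; it is
  -- smaller than ε in absolute value, and the unsigned term from p' is absorbed by Λ.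
  set g : ℝ → ℝ := fun w => Λ * (s' w / (4 * c w ^ 2 * √(c w))) +
    (1 + p.derivative.eval (c w) * (s' w / (2 * c w))) with hg
  have hpc : ∀ w < α, HasDerivAt (fun w => p.eval (c w))
      (p.derivative.eval (c w) * (-s' w / (2 * c w))) w := fun w hw =>
    (p.hasDerivAt (c w)).comp w (hc' w hw)
  have hsqrt : ∀ w < α, HasDerivAt (fun w => √(c w)) (-s' w / (2 * c w) / (2 * √(c w))) w :=
    fun w hw => (hc' w hw).sqrt (hcpos w hw).ne'
  -- The terms cancel to H' = -c'(w - p(c)), so |H'| ≤ ε|c'| on [m, α). As c is monotone, H + εc and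
  -- H - εc are monotone too, which bounds the oscillation of H by that of εc.
  have hH : ∀ w < α, HasDerivAt
      (fun w => speedInt s α w - q (c w) - c w * w + c w * p.eval (c w))
      (s' w / (2 * c w) * (w - p.eval (c w))) w := by
    intro w hw
    have h1 := (((h.hasDerivAt_speedInt w).sub ((hqd (c w)).comp w (hc' w hw))).sub
      ((hc' w hw).mul (hasDerivAt_id w))).add ((hc' w hw).mul (hpc w hw))
    refine h1.congr_deriv ?_
    simp only [id]
    rw [← hc]
    ring
  have hHc : ∀ f : ℝ → ℝ, (∀ w < α, DifferentiableAt ℝ f w) → ContinuousOn f (Ico m α) ∧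
      DifferentiableOn ℝ f (interior (Ico m α)) := fun f hf =>
    ⟨fun w hw => (hf w hw.2).continuousAt.continuousWithinAt,
      fun w hw => (hf w (interior_subset hw).2).differentiableWithinAt⟩
  set H : ℝ → ℝ := fun w => speedInt s α w - q (c w) - c w * w + c w * p.eval (c w) with hHdef
  have hHanti : AntitoneOn (fun w => H w + ε * c w) (Ico m α) := by
    have hdv : ∀ w < α, HasDerivAt (fun w => H w + ε * c w) _ w := fun w hw =>
      (hH w hw).add ((hc' w hw).const_mul ε)
    have hcd := hHc _ fun w hw => (hdv w hw).differentiableAt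
    refine antitoneOn_of_deriv_nonpos (convex_Ico _ _) hcd.1 hcd.2 fun w hw => ?_
    have hw' := interior_subset hw
    rw [(hdv w hw'.2).deriv]
    have h1 := (abs_lt.1 (hp w ⟨hw'.1, hw'.2.le⟩)).2
    have h2 : 0 ≤ s' w / (2 * c w) :=
      div_nonneg (h.deriv_nonneg hw'.2) (by linarith [hcpos w hw'.2])
    rw [neg_div]
    nlinarith
  have hHmono : MonotoneOn (fun w => H w - ε * c w) (Ico m α) := by
    have hdv : ∀ w < α, HasDerivAt (fun w => H w - ε * c w) _ w := fun w hw =>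
      (hH w hw).sub ((hc' w hw).const_mul ε)
    have hcd := hHc _ fun w hw => (hdv w hw).differentiableAt
    refine monotoneOn_of_deriv_nonneg (convex_Ico _ _) hcd.1 hcd.2 fun w hw => ?_
    have hw' := interior_subset hw
    rw [(hdv w hw'.2).deriv]
    have h1 := (abs_lt.1 (hp w ⟨hw'.1, hw'.2.le⟩)).1
    have h2 : 0 ≤ s' w / (2 * c w) :=
      div_nonneg (h.deriv_nonneg hw'.2) (by linarith [hcpos w hw'.2])
    rw [neg_div]
    nlinarith
  have hHosc : ∀ w ∈ Ico m α, ∀ z ∈ Ico m α, H w - H z ≤ ε * cm := by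
    intro w hw z hz
    have w1 := hcle w hw.1
    have z1 := hcle z hz.1
    have w0 := (hcpos w hw.2).le
    have z0 := (hcpos z hz.2).le
    rcases le_total w z with hwz | hwz
    · have := hHmono hw hz hwz
      simp only at this
      nlinarith
    · have := hHanti hz hw hwz
      simp only at this
      nlinarith
  refine ⟨fun w => Λ * (√(c w))⁻¹ + (w - p.eval (c w)),
    fun w => -Λ * √(c w) + (speedInt s α w - q (c w)), g, -ε, ?_, ?_, ?_, ?_, ?_, ?_⟩
  · intro w hw
    have h0 := hcpos w hw
    have h1 := (((hsqrt w hw).inv (Real.sqrt_pos.2 h0).ne').const_mul Λ).add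
      ((hasDerivAt_id w).sub (hpc w hw))
    refine h1.congr_deriv ?_
    rw [hg]
    simp only [Real.sq_sqrt h0.le]
    have hb := Real.sqrt_pos.2 h0
    field_simp
    ring
  · intro w hw
    have h0 := hcpos w hw
    have h1 := ((hsqrt w hw).const_mul (-Λ)).add
      ((h.hasDerivAt_speedInt w).sub ((hqd (c w)).comp w (hc' w hw)))
    refine h1.congr_deriv ?_
    rw [hg, ← hc]
    have hb := Real.sqrt_pos.2 h0
    field_simp
    ring
  · have hs' := h.cont
    have hcc : Continuous c := h.speed_continuous
    have hpd : Continuous fun w => p.derivative.eval (c w) := (Polynomial.continuous _).comp hcc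
    refine ContinuousOn.add (continuousOn_const.mul (hs'.continuousOn.div
      (by fun_prop) fun w hw => ?_)) (continuousOn_const.add (hpd.continuousOn.mul
        (hs'.continuousOn.div (by fun_prop) fun w hw => ?_)))
    · have h0 := hcpos w hw
      have := Real.sqrt_pos.2 h0
      positivity
    · have h0 := hcpos w hw
      positivity
  · intro w hw
    have h0 := hcpos w hw.2
    have h1 := hcle w hw.1
    have hb := Real.sqrt_pos.2 h0
    have hs' := h.deriv_nonneg hw.2
    have hBw : -B ≤ p.derivative.eval (c w) := (abs_le.1 (hB (c w) ⟨h0.le, h1⟩)).1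
    have h2 : c w * √(c w) ≤ cm * √cm :=
      mul_le_mul h1 (Real.sqrt_le_sqrt h1) hb.le hcm0.le
    have h3 : 2 * B * (c w * √(c w)) ≤ Λ := mul_le_mul_of_nonneg_left h2 (by linarith)
    have h4 : B * (s' w / (2 * c w)) ≤ Λ * (s' w / (4 * c w ^ 2 * √(c w))) := by
      have : B * (s' w / (2 * c w)) =
          2 * B * (c w * √(c w)) * (s' w / (4 * c w ^ 2 * √(c w))) := by
        field_simp
        ring
      rw [this]
      exact mul_le_mul_of_nonneg_right h3 (by positivity)
    have h5 : -B * (s' w / (2 * c w)) ≤ p.derivative.eval (c w) * (s' w / (2 * c w)) :=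
      mul_le_mul_of_nonneg_right hBw (by positivity)
    simp only [hg]
    linarith
  · intro w hw
    have h1 := (abs_lt.1 (hp w ⟨hw.1, hw.2.le⟩)).1
    have h2 : 0 ≤ Λ * (√(c w))⁻¹ := by positivity
    linarith
  · intro w hw z hz
    have hQ : ∀ w ∈ Ico m α, (-Λ * √(c w) + (speedInt s α w - q (c w))) +
        (Λ * (√(c w))⁻¹ + (w - p.eval (c w))) * c w = H w + 2 * c w * (w - p.eval (c w)) := by
      intro w hw
      have h0 := hcpos w hw.2
      have hb := Real.sqrt_pos.2 h0
      have h1 : (√(c w))⁻¹ * c w = √(c w) := by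
        rw [inv_mul_eq_div, div_eq_iff hb.ne', Real.mul_self_sqrt h0.le]
      simp only [hHdef]
      linear_combination Λ * h1
    rw [hQ w hw, hQ z hz]
    have h1 := hHosc w hw z hz
    have hw1 := abs_lt.1 (hp w ⟨hw.1, hw.2.le⟩)
    have hz1 := abs_lt.1 (hp z ⟨hz.1, hz.2.le⟩)
    have w1 := hcle w hw.1
    have z1 := hcle z hz.1
    have w0 := (hcpos w hw.2).le
    have z0 := (hcpos z hz.2).le
    nlinarith

end SonicData

namespace IsStrip

variable {s s' : ℝ → ℝ} {α β t₀ t₁ a₁ a₂ : ℝ} {u v ux vx uxx vxx : ℝ → ℝ → ℝ}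

/-- If `u` is bounded below, strips have bounded life span. -/
theorem exists_life_span (h : PSol s s' t₀ u v ux vx uxx vxx) (hs : SonicData s s' α β)
    (ht₁ : t₀ < t₁) (ha : a₁ < a₂) {m : ℝ} (hm : m < α) (hu : ∀ t ≥ t₁, ∀ x, m ≤ u t x) :
    ∃ T ≥ t₁, ∀ γ₁ γ₂, ¬IsStrip s α u ux vx t₁ T a₁ a₂ γ₁ γ₂ := by
  set r₁ := riem s α u v t₁ a₁ with hr₁
  set r₂ := riem s α u v t₁ a₂ with hr₂
  by_cases hδ : r₁ < r₂
  swap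
  · exact ⟨t₁, le_rfl, fun γ₁ γ₂ hS => (hδ (hS.riem_lt h hs ht₁ le_rfl ha)).elim⟩
  set d := 1 * (r₂ - r₁) / 2 with hd
  have hd0 : 0 < d := by rw [hd]; linarith
  obtain ⟨G, P, g, b, hG, hP, hg, hg1, hGb, hflux⟩ := hs.exists_entropy hm hd0
  set K₀ := ∫ x in a₁..a₂, (G (u t₁ x) + 0 * riem s α u v t₁ x) with hK₀
  set Y := |K₀ + (|b|)| + 1 with hY
  have hY0 : 0 < Y := by positivity
  have hYd : 0 < Y / d := by positivity
  refine ⟨t₁ + Y / d, by linarith, fun γ₁ γ₂ hS => ?_⟩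
  set T := t₁ + Y / d with hT
  have hT' : t₁ ≤ T := by linarith
  have hTm := right_mem_Icc.2 hT'
  have hle : ∀ t ∈ Icc t₁ T, γ₁ t ≤ γ₂ t := fun t ht => (hS.lt h hs ht₁ ha ht).le
  have hmem : ∀ t ∈ Icc t₁ T, ∀ x ∈ Icc (γ₁ t) (γ₂ t), u t x ∈ Ico m α := by
    intro t ht x hx
    rw [← uIcc_of_le (hle t ht)] at hx
    exact ⟨hu t ht.1 x, (hS.hyp t ht x hx).1⟩
  -- The flux difference is at most d, half of the bulk decay, so no displacement term is needed.
  -- The integral falls at rate d, while G ≥ b and width at most 1 keep it above -|b|.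
  have key := hS.balance h hs ht₁ hT' ha (l := 0) (κ := 1) (N := 0) hG hP hg
    (fun t ht x hx => by
      have := hg1 _ (hmem t (Ioo_subset_Icc_self ht) x hx)
      linarith)
    (fun t ht => by
      have ht' := Ioo_subset_Icc_self ht
      have := hflux _ (hmem t ht' _ (right_mem_Icc.2 (hle t ht')))
        _ (hmem t ht' _ (left_mem_Icc.2 (hle t ht')))
      simp only [zero_mul, add_zero, ← hr₁, ← hr₂]; exact this)
  have hwid := hS.width_le h hs ht₁ ha hTm
  have hlow : -|b| ≤ ∫ x in (γ₁ T)..(γ₂ T), (G (u T x) + 0 * riem s α u v T x) := by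
    have hcont : ContinuousOn (fun x => G (u T x) + 0 * riem s α u v T x)
        (uIcc (γ₁ T) (γ₂ T)) := by
      simp only [zero_mul, add_zero]
      intro x hx
      exact ContinuousAt.comp_continuousWithinAt
        (hG _ (hS.hyp T hTm x hx).1).continuousAt
        (h.continuous_u (ht₁.trans_le hT')).continuousAt.continuousWithinAt
    calc -|b| ≤ ∫ x in (γ₁ T)..(γ₂ T), -|b| := by
          rw [intervalIntegral.integral_const, smul_eq_mul]
          nlinarith [abs_nonneg b, hle T hTm]
      _ ≤ _ := by
          refine intervalIntegral.integral_mono_on (hle T hTm) (by simp)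
            hcont.intervalIntegrable fun x hx => ?_
          have := hGb _ (hmem T hTm x hx)
          linarith [neg_abs_le b]
  have hdT : d * (T - t₁) = Y := by
    rw [hT, add_sub_cancel_left, mul_div_cancel₀ _ hd0.ne']
  have := le_abs_self (K₀ + (|b|))
  simp only [← hr₁, ← hr₂, ← hd, ← hK₀] at key
  linarith

end IsStrip

/-! ### No elliptic states inside an enclosed region -/

/-- A smooth cutoff increasing from `0` to `1` on `[α, β]`. -/
noncomputable def cutoff (α β w : ℝ) : ℝ := Real.smoothTransition ((w - α) / (β - α))

theorem contDiff_cutoff (α β : ℝ) : ContDiff ℝ 2 (cutoff α β) :=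
  Real.smoothTransition.contDiff.comp ((contDiff_id.sub contDiff_const).div_const _)

theorem monotone_cutoff {α β : ℝ} (h : α < β) : Monotone (cutoff α β) := fun _ _ hxy =>
  Real.smoothTransition.monotone
    (div_le_div_of_nonneg_right (sub_le_sub_right hxy α) (sub_pos.2 h).le)

theorem cutoff_eq_zero_iff {α β w : ℝ} (h : α < β) : cutoff α β w = 0 ↔ w ≤ α := by
  rw [cutoff, Real.smoothTransition.zero_iff_nonpos, div_le_iff₀ (sub_pos.2 h)]
  simp

theorem cutoff_eq_one {α β w : ℝ} (h : α < β) (hw : β ≤ w) : cutoff α β w = 1 := by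
  refine Real.smoothTransition.one_of_one_le ?_
  rw [le_div_iff₀ (sub_pos.2 h)]
  linarith

/-- The cutoff varies only on [α, β], where s ≥ 0; the sign of s beyond β, negative in the cubic
case, does not matter. -/
theorem SonicData.mul_deriv_cutoff_nonneg {s s' : ℝ → ℝ} {α β : ℝ} (h : SonicData s s' α β)
    (w : ℝ) : 0 ≤ s w * deriv (cutoff α β) w := by
  have hmono : 0 ≤ deriv (cutoff α β) w := (monotone_cutoff h.lt).deriv_nonneg
  rcases lt_or_ge w α with hw | hw
  · have : cutoff α β =ᶠ[𝓝 w] fun _ => 0 := by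
      filter_upwards [Iio_mem_nhds hw] with y hy
      exact (cutoff_eq_zero_iff h.lt).2 (le_of_lt hy)
    rw [this.deriv_eq]; simp
  rcases le_or_gt w β with hw' | hw'
  · exact mul_nonneg (h.nonneg w ⟨hw, hw'⟩) hmono
  · have : cutoff α β =ᶠ[𝓝 w] fun _ => 1 := by
      filter_upwards [Ioi_mem_nhds hw'] with y hy
      exact cutoff_eq_one h.lt (le_of_lt hy)
    rw [this.deriv_eq]; simp

namespace PSol

variable {s s' : ℝ → ℝ} {α β t₀ : ℝ} {u v ux vx uxx vxx : ℝ → ℝ → ℝ}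

/-- No elliptic state can occur in a region enclosed by two curves of hyperbolic states that meet
after finite time. -/
theorem le_of_enclosed (h : PSol s s' t₀ u v ux vx uxx vxx) (hs : SonicData s s' α β)
    {t₁ T : ℝ} (ht₁ : t₀ < t₁) (hu : ∀ x, u t₁ x < α) {L R : ℝ → ℝ}
    (hL : ∀ t ∈ Icc t₁ T, HasDerivWithinAt L (speed s α (u t (L t))) (Icc t₁ T) t)
    (hR : ∀ t ∈ Icc t₁ T, HasDerivWithinAt R (-speed s α (u t (R t))) (Icc t₁ T) t)
    (huL : ∀ t ∈ Icc t₁ T, u t (L t) < α) (huR : ∀ t ∈ Icc t₁ T, u t (R t) < α)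
    (hT : R T ≤ L T) {t x : ℝ} (ht : t ∈ Icc t₁ T) (hx : x ∈ Ioo (L t) (R t)) : u t x ≤ α := by
  have mL : MonotoneOn L (Icc t₁ T) := IsStrip.monotoneOn_of_deriv hL
  have mR : AntitoneOn R (Icc t₁ T) := by
    refine antitoneOn_of_deriv_nonpos (convex_Icc _ _) (fun t ht => (hR t ht).continuousWithinAt)
      (fun t ht => ?_) (fun t ht => ?_) <;> rw [interior_Icc] at ht <;>
      have hd := (hR t (Ioo_subset_Icc_self ht)).hasDerivAt (Icc_mem_nhds ht.1 ht.2)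
    · exact hd.differentiableAt.differentiableWithinAt
    · rw [hd.deriv]; exact neg_nonpos.2 (SonicData.speed_nonneg _)
  have cL : ContinuousOn L (Icc t₁ T) := fun t ht => (hL t ht).continuousWithinAt
  have cR : ContinuousOn R (Icc t₁ T) := fun t ht => (hR t ht).continuousWithinAt
  -- the meeting time
  obtain ⟨τ, hτ, hτe⟩ : ∃ τ ∈ Icc t T, R τ - L τ = 0 := by
    have hsub : Icc t T ⊆ Icc t₁ T := Icc_subset_Icc_left ht.1
    have := intermediate_value_Icc' ht.2 ((cR.sub cL).mono hsub)
    exact this ⟨by simpa using hT, by simpa using (hx.1.trans hx.2).le⟩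
  have hτ1 : t₁ ≤ τ := ht.1.trans hτ.1
  have hτm : τ ∈ Icc t₁ T := ⟨hτ1, hτ.2⟩
  have hsub : Icc t₁ τ ⊆ Icc t₁ T := Icc_subset_Icc_right hτ.2
  have hsub' : Ioo t₁ τ ⊆ Icc t₁ T := Ioo_subset_Icc_self.trans hsub
  have hLR : ∀ r ∈ Icc t₁ τ, L r ≤ R r := by
    intro r hr
    have h1 := mL (hsub hr) hτm hr.2
    have h2 := mR (hsub hr) hτm hr.2
    linarith
  set φ := cutoff α β with hφ
  have hφd : ∀ w, HasDerivAt φ (deriv φ w) w := fun w =>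
    ((contDiff_cutoff α β).differentiable (by norm_num) w).hasDerivAt
  have hφc : Continuous (deriv φ) := (contDiff_cutoff α β).continuous_deriv (by norm_num)
  have hφ0 : ∀ w ≤ α, φ w = 0 := fun w hw => (cutoff_eq_zero_iff hs.lt).2 hw
  have hφn : ∀ w, 0 ≤ deriv φ w := fun w => (monotone_cutoff hs.lt).deriv_nonneg
  have hcu : ∀ t x, t₀ < t → ContinuousAt (fun p : ℝ × ℝ => u p.1 p.2) (t, x) := fun t x ht =>
    (h.du t ht x).continuousAt
  have hcux : ∀ t x, t₀ < t → ContinuousAt (fun p : ℝ × ℝ => ux p.1 p.2) (t, x) :=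
    fun t x ht => (h.dux t ht x).continuousAt
  have hcvx : ∀ t x, t₀ < t → ContinuousAt (fun p : ℝ × ℝ => vx p.1 p.2) (t, x) :=
    fun t x ht => (h.dvx t ht x).continuousAt
  have hnhd : ∀ t x, t₀ < t → Ioi t₀ ×ˢ univ ∈ 𝓝 ((t, x) : ℝ × ℝ) := fun t x ht =>
    (isOpen_Ioi.prod isOpen_univ).mem_nhds ⟨ht, trivial⟩
  have hcuxx : ∀ t x, t₀ < t → ContinuousAt (fun p : ℝ × ℝ => uxx p.1 p.2) (t, x) :=
    fun t x ht => h.cuxx.continuousAt (hnhd t x ht)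
  have hcvxx : ∀ t x, t₀ < t → ContinuousAt (fun p : ℝ × ℝ => vxx p.1 p.2) (t, x) :=
    fun t x ht => h.cvxx.continuousAt (hnhd t x ht)
  have hcf : ∀ {f : ℝ → ℝ}, Continuous f → ∀ t x, t₀ < t →
      ContinuousAt (fun p : ℝ × ℝ => f (u p.1 p.2)) (t, x) := fun hf t x ht =>
    ContinuousAt.comp (f := fun p : ℝ × ℝ => u p.1 p.2) hf.continuousAt (hcu t x ht)
  have hφcont : Continuous φ := (contDiff_cutoff α β).continuous
  have hEd : ∀ t x, t₀ < t → HasFDerivAt (fun p : ℝ × ℝ => φ (u p.1 p.2) * vx p.1 p.2)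
      (pairing (φ (u t x) * (s' (u t x) * ux t x ^ 2 + s (u t x) * uxx t x) +
          vx t x * (deriv φ (u t x) * -vx t x))
        (φ (u t x) * vxx t x + vx t x * (deriv φ (u t x) * ux t x))) (t, x) := by
    intro t x ht
    exact (HasDerivAt.comp_pairing (f := fun p : ℝ × ℝ => u p.1 p.2) (p := (t, x))
      (hφd (u t x)) (h.du t ht x)).pairing_mul (h.dvx t ht x)
  have hEtc : ∀ t x, t₀ < t → ContinuousAt (fun p : ℝ × ℝ =>
      φ (u p.1 p.2) * (s' (u p.1 p.2) * ux p.1 p.2 ^ 2 + s (u p.1 p.2) * uxx p.1 p.2) +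
          vx p.1 p.2 * (deriv φ (u p.1 p.2) * -vx p.1 p.2)) (t, x) := fun t x ht =>
    ((hcf hφcont t x ht).mul (((hcf hs.cont t x ht).mul ((hcux t x ht).pow 2)).add
      ((hcf hs.continuous t x ht).mul (hcuxx t x ht)))).add
      ((hcvx t x ht).mul ((hcf hφc t x ht).mul (hcvx t x ht).neg))
  have hDc : ∀ t x, t₀ < t → ContinuousAt (fun p : ℝ × ℝ =>
      s (u p.1 p.2) * deriv φ (u p.1 p.2) * ux p.1 p.2 ^ 2 +
        deriv φ (u p.1 p.2) * vx p.1 p.2 ^ 2) (t, x) := fun t x ht =>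
    (((hcf hs.continuous t x ht).mul (hcf hφc t x ht)).mul ((hcux t x ht).pow 2)).add
      ((hcf hφc t x ht).mul ((hcvx t x ht).pow 2))
  have hslice : ∀ {f : ℝ → ℝ → ℝ}, (∀ t x, t₀ < t →
      ContinuousAt (fun p : ℝ × ℝ => f p.1 p.2) (t, x)) → ∀ t, t₀ < t → Continuous (f t) := by
    intro f hf t ht
    exact continuous_iff_continuousAt.2 fun x =>
      ContinuousAt.comp (f := fun x => (t, x)) (hf t x ht) (by fun_prop)
  set D : ℝ → ℝ → ℝ := fun t x =>
    s (u t x) * deriv φ (u t x) * ux t x ^ 2 + deriv φ (u t x) * vx t x ^ 2 with hD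
  have hD0 : ∀ t x, 0 ≤ D t x := fun t x =>
    add_nonneg (mul_nonneg (hs.mul_deriv_cutoff_nonneg _) (sq_nonneg _))
      (mul_nonneg (hφn _) (sq_nonneg _))
  -- Since v_xt = (s(u) u_x)_x, integration by parts gives K' = -∫ D ≤ 0. All boundary terms carry
  -- the factor φ(u), which vanishes on the hyperbolic curves L and R.
  set K : ℝ → ℝ := fun t => ∫ x in (L t)..(R t), φ (u t x) * vx t x with hK
  have hdL : ∀ r ∈ Ioo t₁ τ, HasDerivAt L (speed s α (u r (L r))) r := fun r hr =>
    (hL r (hsub' hr)).hasDerivAt (Icc_mem_nhds hr.1 (hr.2.trans_le hτ.2))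
  have hdR : ∀ r ∈ Ioo t₁ τ, HasDerivAt R (-speed s α (u r (R r))) r := fun r hr =>
    (hR r (hsub' hr)).hasDerivAt (Icc_mem_nhds hr.1 (hr.2.trans_le hτ.2))
  have csp : ∀ {γ : ℝ → ℝ}, ContinuousOn γ (Icc t₁ T) →
      ContinuousOn (fun t => speed s α (u t (γ t))) (Ioo t₁ τ) := by
    intro γ hγ t ht
    exact ContinuousAt.comp_continuousWithinAt (f := fun r => (r, γ r))
      (hcf hs.speed_continuous t (γ t) (ht₁.trans ht.1))
      ((continuousOn_id.prodMk (hγ.mono hsub')) t ht)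
  have hKd : ∀ r ∈ Ioo t₁ τ, HasDerivAt K (-∫ x in (L r)..(R r), D r x) r := by
    intro r hr
    have hr0 : t₀ < r := ht₁.trans hr.1
    have h1 := hasDerivAt_integral_between (E := fun t x => φ (u t x) * vx t x)
      (Et := fun t x => φ (u t x) * (s' (u t x) * ux t x ^ 2 + s (u t x) * uxx t x) +
          vx t x * (deriv φ (u t x) * -vx t x))
      (Ex := fun t x => φ (u t x) * vxx t x + vx t x * (deriv φ (u t x) * ux t x))
      hr hdL hdR (csp cL) (csp cR).neg (fun r hr => hLR r (Ioo_subset_Icc_self hr))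
      (fun p hp => hEd p.1 p.2 (ht₁.trans hp.1.1))
      (fun p hp => (hEtc p.1 p.2 (ht₁.trans hp.1.1)).continuousWithinAt)
      (fun p hp => by
        have hp0 := ht₁.trans hp.1.1
        exact (((hcf hφcont p.1 p.2 hp0).mul (hcvxx p.1 p.2 hp0)).add ((hcvx p.1 p.2 hp0).mul
          ((hcf hφc p.1 p.2 hp0).mul (hcux p.1 p.2 hp0)))).continuousWithinAt)
    refine h1.congr_deriv ?_
    rw [hφ0 _ (huL r (hsub' hr)).le, hφ0 _ (huR r (hsub' hr)).le]
    simp only [zero_mul, sub_zero, add_zero]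
    have h2 : ∀ x, HasDerivAt (fun x => φ (u r x) * (s (u r x) * ux r x))
        (deriv φ (u r x) * ux r x * (s (u r x) * ux r x) +
          φ (u r x) * (s' (u r x) * ux r x * ux r x + s (u r x) * uxx r x)) x := fun x =>
      ((hφd (u r x)).comp x (h.du r hr0 x).snd_deriv).mul
        (((hs.hasDeriv (u r x)).comp x (h.du r hr0 x).snd_deriv).mul (h.dux r hr0 x).snd_deriv)
    have hEtr := hslice (f := fun t x => φ (u t x) * (s' (u t x) * ux t x ^ 2 + s (u t x) * uxx t x) +
          vx t x * (deriv φ (u t x) * -vx t x)) hEtc r hr0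
    have hDr := hslice (f := D) hDc r hr0
    have h3 : (fun x => deriv φ (u r x) * ux r x * (s (u r x) * ux r x) +
          φ (u r x) * (s' (u r x) * ux r x * ux r x + s (u r x) * uxx r x)) =
        fun x => (φ (u r x) * (s' (u r x) * ux r x ^ 2 + s (u r x) * uxx r x) +
          vx r x * (deriv φ (u r x) * -vx r x)) + D r x := by
      funext x; simp only [hD]; ring
    have h4 := intervalIntegral.integral_eq_sub_of_hasDerivAt (a := L r) (b := R r)
      (fun x _ => h2 x) (by rw [h3]; exact (hEtr.add hDr).intervalIntegrable _ _)
    rw [h3, intervalIntegral.integral_add (hEtr.intervalIntegrable _ _)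
      (hDr.intervalIntegrable _ _), hφ0 _ (huL r (hsub' hr)).le, hφ0 _ (huR r (hsub' hr)).le] at h4
    linarith
  have hKc : ContinuousOn K (Icc t₁ τ) :=
    continuousOn_integral_between (E := fun t x => φ (u t x) * vx t x) hτ1 (cL.mono hsub)
      (cR.mono hsub) hLR
      fun p hp => (hEd p.1 p.2 (ht₁.trans_le hp.1.1)).continuousAt.continuousWithinAt
  have hKanti : AntitoneOn K (Icc t₁ τ) := by
    refine antitoneOn_of_deriv_nonpos (convex_Icc _ _) hKc (fun r hr => ?_) (fun r hr => ?_) <;>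
      rw [interior_Icc] at hr
    · exact (hKd r hr).differentiableAt.differentiableWithinAt
    · rw [(hKd r hr).deriv]
      exact neg_nonpos.2 (intervalIntegral.integral_nonneg (hLR r (Ioo_subset_Icc_self hr))
        fun x _ => hD0 r x)
  have hK1 : K t₁ = 0 := by
    simp only [hK]
    rw [intervalIntegral.integral_congr (g := fun _ => 0) fun x _ => ?_]
    · simp
    · simp only [hφ0 _ (hu x).le, zero_mul]
  have hKτ : K τ = 0 := by
    simp only [hK]
    rw [sub_eq_zero.1 hτe, intervalIntegral.integral_same]
  -- K decreases from 0, as the initial state is hyperbolic, to 0, as the interval has closed up at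
  -- τ. So the dissipation D vanishes throughout.
  have hK0 : ∀ r ∈ Icc t₁ τ, K r = 0 := fun r hr =>
    le_antisymm (hK1 ▸ hKanti (left_mem_Icc.2 hτ1) hr hr.1)
      (hKτ ▸ hKanti hr (right_mem_Icc.2 hτ1) hr.2)
  -- L moves right and R moves left, so x was inside the interval at all earlier times. The quantity
  -- that vanishes is minus the time derivative of φ(u) at x, so φ(u) keeps its initial value 0
  -- there.
  have hvanish : ∀ r ∈ Ioo t₁ t, deriv φ (u r x) * vx r x = 0 := by
    intro r hr
    have hrτ : r ∈ Ioo t₁ τ := ⟨hr.1, hr.2.trans_le hτ.1⟩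
    have hLx : L r < x := (mL (hsub' hrτ) ht hr.2.le).trans_lt hx.1
    have hRx : x < R r := hx.2.trans_le (mR (hsub' hrτ) ht hr.2.le)
    have hint : ∫ x in (L r)..(R r), D r x = 0 := by
      have h1 : K =ᶠ[𝓝 r] fun _ => 0 := by
        filter_upwards [isOpen_Ioo.mem_nhds hrτ] with q hq
        exact hK0 q (Ioo_subset_Icc_self hq)
      have h2 := (hKd r hrτ).unique ((hasDerivAt_const r (0 : ℝ)).congr_of_eventuallyEq h1)
      linarith
    have hDx : D r x = 0 := by
      by_contra hne
      have := intervalIntegral.integral_pos (hLx.trans hRx)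
        (hslice (f := D) hDc r (ht₁.trans hr.1)).continuousOn (fun y _ => hD0 r y)
        ⟨x, ⟨hLx.le, hRx.le⟩, lt_of_le_of_ne (hD0 r x) (Ne.symm hne)⟩
      exact this.ne' hint
    have h1 := mul_nonneg (hs.mul_deriv_cutoff_nonneg (u r x)) (sq_nonneg (ux r x))
    have h2 := mul_nonneg (hφn (u r x)) (sq_nonneg (vx r x))
    simp only [hD] at hDx
    have h3 : deriv φ (u r x) * vx r x ^ 2 = 0 := by linarith
    rcases mul_eq_zero.1 h3 with h4 | h4
    · rw [h4, zero_mul]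
    · rw [pow_eq_zero_iff (by norm_num)] at h4
      rw [h4, mul_zero]
  have hconst : φ (u t x) ≤ φ (u t₁ x) := by
    have hd : ∀ r, t₀ < r → HasDerivAt (fun r => φ (u r x)) (deriv φ (u r x) * -vx r x) r :=
      fun r hr => HasDerivAt.comp (h₂ := φ) (h := fun r => u r x) r (hφd (u r x))
        (h.du r hr x).fst_deriv
    refine antitoneOn_of_deriv_nonpos (f := fun r => φ (u r x)) (convex_Icc t₁ t)
      (fun r hr => (hd r (ht₁.trans_le hr.1)).continuousAt.continuousWithinAt)
      (fun r hr => ?_) (fun r hr => ?_) (left_mem_Icc.2 ht.1) (right_mem_Icc.2 ht.1) ht.1 <;>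
      rw [interior_Icc] at hr
    · exact (hd r (ht₁.trans hr.1)).differentiableAt.differentiableWithinAt
    · rw [(hd r (ht₁.trans hr.1)).deriv, mul_neg, hvanish r hr, neg_zero]
  rw [hφ0 _ (hu x).le] at hconst
  have h0 : 0 ≤ φ (u t x) := Real.smoothTransition.nonneg _
  exact (cutoff_eq_zero_iff hs.lt).1 (le_antisymm hconst h0)

end PSol

/-! ### Persistence of u ≤ α and constancy -/

namespace PSol

variable {s s' : ℝ → ℝ} {α β t₀ t₁ : ℝ} {u v ux vx uxx vxx : ℝ → ℝ → ℝ}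

theorem continuous_riem (h : PSol s s' t₀ u v ux vx uxx vxx) (hs : SonicData s s' α β) {t : ℝ}
    (ht : t₀ < t) : Continuous (riem s α u v t) :=
  continuous_iff_continuousAt.2 fun x => (h.hasFDerivAt_riem hs ht x).snd_deriv.continuousAt

/-- The two Riemann invariants determine `u`. -/
theorem riem_add_riem_reflect (t x : ℝ) :
    riem s α u v t x + riem s α (fun t x => u t (-x)) (fun t x => -v t (-x)) t (-x) =
      2 * speedInt s α (u t x) := by
  simp only [riem, neg_neg]; ring

/-- If one Riemann invariant is constant initially, the solution stays hyperbolic. -/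
theorem le_of_riem_const (h : PSol s s' t₀ u v ux vx uxx vxx) (hs : SonicData s s' α β)
    (ht₁ : t₀ < t₁) (hu : ∀ x, u t₁ x < α)
    (hc : ∀ x y, riem s α u v t₁ x = riem s α u v t₁ y) : ∀ t ≥ t₁, ∀ x, u t x ≤ α := by
  intro t ht x
  by_contra! hgt
  obtain ⟨xm, -, hxm, -⟩ := exists_bounds_of_periodic (h.continuous_u ht₁) (h.pu t₁ ht₁)
  obtain ⟨ym, -, hym, -⟩ := exists_bounds_of_periodic (h.reflect.continuous_riem hs ht₁)
    (h.reflect.periodic_riem (α := α) ht₁)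
  obtain ⟨η, hη1, hη2⟩ := exists_between (hu xm)
  -- the first time at which the level `η` is reached
  have hcomp : IsCompact ((Icc t₁ t ×ˢ Icc (0 : ℝ) 1) ∩
      (fun p : ℝ × ℝ => u p.1 p.2) ⁻¹' Ici η) := by
    refine (isCompact_Icc.prod isCompact_Icc).of_isClosed_subset
      (ContinuousOn.preimage_isClosed_of_isClosed (fun p hp => ?_)
        (isClosed_Icc.prod isClosed_Icc) isClosed_Ici) inter_subset_left
    exact (h.du p.1 (ht₁.trans_le hp.1.1) p.2).continuousAt.continuousWithinAt
  obtain ⟨x', hx', hxx'⟩ := exists_mem_Icc_periodic (h.pu t (ht₁.trans_le ht)) x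
  obtain ⟨⟨τ, y⟩, ⟨⟨hτ, -⟩, hτy⟩, hmin⟩ := hcomp.exists_isMinOn (f := Prod.fst)
    ⟨(t, x'), ⟨⟨ht, le_rfl⟩, hx'⟩, by
      simp only [mem_preimage, mem_Ici, hxx']; linarith⟩ continuousOn_fst
  simp only [mem_preimage, mem_Ici] at hτ hτy
  have hbefore : ∀ r ∈ Ico t₁ τ, ∀ z, u r z < η := by
    intro r hr z
    by_contra! hge
    obtain ⟨z', hz', hzz'⟩ := exists_mem_Icc_periodic (h.pu r (ht₁.trans_le hr.1)) z
    have := hmin (a := (r, z')) ⟨⟨⟨hr.1, hr.2.le.trans hτ.2⟩, hz'⟩, by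
      simpa only [mem_preimage, mem_Ici, hzz'] using hge⟩
    exact (not_le.2 hr.2) this
  have hτ1 : t₁ < τ := by
    refine lt_of_le_of_ne hτ.1 fun heq => ?_
    rw [← heq] at hτy
    linarith [hxm y]
  have hle : ∀ r ∈ Icc t₁ τ, ∀ z, u r z ≤ α := by
    intro r hr z
    rcases hr.2.lt_or_eq with hlt | rfl
    · exact ((hbefore r ⟨hr.1, hlt⟩ z).trans hη2).le
    · have hlim : Tendsto (fun q => u q z) (𝓝[<] r) (𝓝 (u r z)) :=
        (h.du r (ht₁.trans hτ1) z).fst_deriv.continuousAt.mono_left nhdsWithin_le_nhds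
      refine (le_of_tendsto hlim ?_).trans hη2.le
      filter_upwards [Ioo_mem_nhdsLT hτ1] with q hq
      exact (hbefore q ⟨hq.1.le, hq.2⟩ z).le
  have hτm := right_mem_Icc.2 hτ1.le
  -- At the first time τ, 2C(u) = r + r̄ is at most the constant initial r plus the maximum of r̄,
  -- which is 2C(u) at an initial point. So u has not risen above its initial maximum, let alone to
  -- η.
  have h1 := h.riem_le hs ht₁ hle (fun z => (hc z (-ym)).le) τ hτm y
  have h2 := h.reflect.riem_le hs ht₁ (fun r hr z => hle r hr (-z)) hym τ hτm (-y)
  have h3 := riem_add_riem_reflect (s := s) (α := α) (u := u) (v := v) τ y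
  have h4 := riem_add_riem_reflect (s := s) (α := α) (u := u) (v := v) t₁ (-ym)
  rw [neg_neg] at h4
  have h5 : speedInt s α (u τ y) ≤ speedInt s α (u t₁ (-ym)) := by linarith
  have h6 := (hs.speedInt_strictMonoOn.le_iff_le (hle τ hτm y) (hu _).le).1 h5
  linarith [hxm (-ym)]

/-- A nonconstant Riemann invariant increases on some interval. -/
theorem exists_interval_riemX_pos (h : PSol s s' t₀ u v ux vx uxx vxx) (hs : SonicData s s' α β)
    (ht₁ : t₀ < t₁) (hc : ¬∀ x y, riem s α u v t₁ x = riem s α u v t₁ y) :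
    ∃ a₁ a₂, a₁ < a₂ ∧ ∀ x ∈ Icc a₁ a₂, 0 < riemX s α u ux vx t₁ x := by
  have hd := fun x => (h.hasFDerivAt_riem hs ht₁ x).snd_deriv
  have hper := h.periodic_riem (α := α) ht₁
  obtain ⟨x, hx⟩ : ∃ x, 0 < riemX s α u ux vx t₁ x := by
    by_contra! hle
    have hanti : Antitone (riem s α u v t₁) := antitone_of_deriv_nonpos
      (fun x => (hd x).differentiableAt) fun x => (hd x).deriv.trans_le (hle x)
    refine hc fun x y => ?_
    have key : ∀ x y, riem s α u v t₁ x ≤ riem s α u v t₁ y := by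
      intro x y
      obtain ⟨n, hn⟩ := exists_nat_ge (y - x)
      have := hper.nat_mul n x
      rw [mul_one] at this
      rw [← this]
      exact hanti (by linarith)
    exact le_antisymm (key x y) (key y x)
  have hcont : ContinuousAt (riemX s α u ux vx t₁) x :=
    ContinuousAt.comp (f := fun x => (t₁, x)) (h.continuousAt_riemX hs ht₁ x) (by fun_prop)
  obtain ⟨ε, hε, hball⟩ := Metric.eventually_nhds_iff.1 (hcont.eventually (lt_mem_nhds hx))
  refine ⟨x, x + ε / 2, by linarith, fun y hy => hball ?_⟩
  rw [Real.dist_eq, abs_of_nonneg (by linarith [hy.1])]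
  linarith [hy.2]

/-- Characteristics have speed bounded on bounded time intervals. -/
theorem exists_bound_characteristic (h : PSol s s' t₀ u v ux vx uxx vxx)
    (hs : SonicData s s' α β) (ht₁ : t₀ < t₁) (a : ℝ) {t : ℝ} (ht : t₁ ≤ t) :
    ∃ B, ∀ T ≥ t, ∀ γ : ℝ → ℝ, γ t₁ = a →
      (∀ r ∈ Icc t₁ T, HasDerivWithinAt γ (speed s α (u r (γ r))) (Icc t₁ T) r) → γ t ≤ B := by
  -- Only values of u up to time t enter, so the bound is independent of T and may be fixed before T
  -- is chosen.
  obtain ⟨N, -, hN⟩ := exists_bound_of_periodic (f := u) (t₁ := t₁) (T := t)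
    (fun r hr x => (h.du r (ht₁.trans_le hr.1) x).continuousAt)
    (fun r hr => h.pu r (ht₁.trans_le hr.1))
  refine ⟨a + speed s α (-N) * (t - t₁), fun T hT γ hγ0 hγ => ?_⟩
  have hsub : Icc t₁ t ⊆ Icc t₁ T := Icc_subset_Icc_right hT
  have hd : ∀ r ∈ interior (Icc t₁ t), HasDerivAt γ (speed s α (u r (γ r))) r := by
    intro r hr
    rw [interior_Icc] at hr
    exact (hγ r (hsub (Ioo_subset_Icc_self hr))).hasDerivAt
      (Icc_mem_nhds hr.1 (hr.2.trans_le hT))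
  have := (convex_Icc t₁ t).image_sub_le_mul_sub_of_deriv_le (f := γ)
    (fun r hr => ((hγ r (hsub hr)).mono hsub).continuousWithinAt)
    (fun r hr => (hd r hr).differentiableAt.differentiableWithinAt) (C := speed s α (-N))
    (fun r hr => by
      rw [(hd r hr).deriv]
      exact hs.speed_antitone (neg_le_of_abs_le (hN r (interior_subset hr) _)))
    t₁ (left_mem_Icc.2 ht) t (right_mem_Icc.2 ht) ht
  linarith

/-- If both Riemann invariants are nonconstant initially, characteristics of the two families
enclose every point, so the solution does not become elliptic. -/
theorem le_of_riem_not_const (h : PSol s s' t₀ u v ux vx uxx vxx) (hs : SonicData s s' α β)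
    (ht₁ : t₀ < t₁) (hu : ∀ x, u t₁ x < α)
    (hc : ¬∀ x y, riem s α u v t₁ x = riem s α u v t₁ y)
    (hc' : ¬∀ x y, riem s α (fun t x => u t (-x)) (fun t x => -v t (-x)) t₁ x =
      riem s α (fun t x => u t (-x)) (fun t x => -v t (-x)) t₁ y) :
    ∀ t ≥ t₁, ∀ x, u t x ≤ α := by
  intro t ht x
  obtain ⟨a₁, a₂, ha, hw⟩ := h.exists_interval_riemX_pos hs ht₁ hc
  obtain ⟨b₁, b₂, hb, hw'⟩ := h.reflect.exists_interval_riemX_pos hs ht₁ hc'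
  obtain ⟨A, hA⟩ := h.exists_bound_characteristic hs ht₁ a₁ ht
  obtain ⟨B, hB⟩ := h.reflect.exists_bound_characteristic hs ht₁ b₁ ht
  -- Whole-period shifts place γ - n to the left of x and -δ + m to its right at time t. Later γ > n
  -- + m and δ > 0, so the two curves have crossed by time T.
  obtain ⟨n, hn⟩ := exists_nat_gt (A - x)
  obtain ⟨m, hm⟩ := exists_nat_gt (B + x)
  obtain ⟨T₁, -, hT₁⟩ := IsStrip.exists_far h hs ht₁ ha (n + m)
  obtain ⟨T₂, -, hT₂⟩ := IsStrip.exists_far h.reflect hs ht₁ hb 0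
  set T := max t (max T₁ T₂) with hT
  have htT : t ≤ T := le_max_left _ _
  have h1T : T₁ ≤ T := (le_max_left _ _).trans (le_max_right _ _)
  have h2T : T₂ ≤ T := (le_max_right _ _).trans (le_max_right _ _)
  obtain ⟨γ, γ', hS⟩ := h.exists_isStrip hs ht₁ (ht.trans htT) hu ha.le hw
  obtain ⟨δ, δ', hS'⟩ := h.reflect.exists_isStrip hs ht₁ (ht.trans htT) (fun x => hu (-x)) hb.le hw'
  have hfar := hT₁ T h1T γ γ' hS
  have hfar' := hT₂ T h2T δ δ' hS'
  have hγt := hA T htT γ hS.init₁ hS.deriv₁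
  have hδt := hB T htT δ hS'.init₁ hS'.deriv₁
  have hpm : ∀ r ∈ Icc t₁ T, ∀ y, ∀ k : ℕ, u r (y - k) = u r y := fun r hr y k => by
    have := (h.pu r (ht₁.trans_le hr.1)).sub_nat_mul_eq (x := y) k
    rwa [mul_one] at this
  have hpp : ∀ r ∈ Icc t₁ T, ∀ y, ∀ k : ℕ, u r (y + k) = u r y := fun r hr y k => by
    have := (h.pu r (ht₁.trans_le hr.1)).nat_mul k y
    rwa [mul_one] at this
  refine h.le_of_enclosed hs ht₁ hu (T := T) (L := fun r => γ r - n) (R := fun r => -δ r + m)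
    (fun r hr => ?_) (fun r hr => ?_) (fun r hr => ?_) (fun r hr => ?_) ?_ ⟨ht, htT⟩ ⟨?_, ?_⟩
  · simp only [hpm r hr]
    exact (hS.deriv₁ r hr).sub_const _
  · simp only [hpp r hr]
    exact (hS'.deriv₁ r hr).neg.add_const _
  · simp only [hpm r hr]
    exact (hS.hyp r hr _ left_mem_uIcc).1
  · simp only [hpp r hr]
    exact (hS'.hyp r hr _ left_mem_uIcc).1
  · linarith
  · linarith
  · linarith

/-- If the solution is never elliptic, the Riemann invariant is constant initially. -/
theorem riem_const_of_le (h : PSol s s' t₀ u v ux vx uxx vxx) (hs : SonicData s s' α β)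
    (ht₁ : t₀ < t₁) (hu : ∀ x, u t₁ x < α) (hle : ∀ t ≥ t₁, ∀ x, u t x ≤ α) :
    ∀ x y, riem s α u v t₁ x = riem s α u v t₁ y := by
  by_contra hc
  obtain ⟨a₁, a₂, ha, hw⟩ := h.exists_interval_riemX_pos hs ht₁ hc
  obtain ⟨-, p, -, hp⟩ := exists_bounds_of_periodic (h.continuous_riem hs ht₁)
    (h.periodic_riem (α := α) ht₁)
  obtain ⟨-, q, -, hq⟩ := exists_bounds_of_periodic (h.reflect.continuous_riem hs ht₁)
    (h.reflect.periodic_riem (α := α) ht₁)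
  set A := riem s α u v t₁ p
  set B := riem s α (fun t x => u t (-x)) (fun t x => -v t (-x)) t₁ q
  -- The maximum principle keeps r ≥ A and r̄ ≥ B, hence C(u) ≥ (A + B)/2 for all later times.
  obtain ⟨m, hm, hmle⟩ := hs.exists_lt_of_speedInt_ge ((A + B) / 2)
  have hlow : ∀ t ≥ t₁, ∀ x, m ≤ u t x := by
    intro t ht x
    have hmem := right_mem_Icc.2 ht
    have h1 := h.le_riem hs ht₁ (fun r hr z => hle r hr.1 z) hp t hmem x
    have h2 := h.reflect.le_riem hs ht₁ (fun r hr z => hle r hr.1 (-z)) hq t hmem (-x)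
    have h3 := riem_add_riem_reflect (s := s) (α := α) (u := u) (v := v) t x
    exact hmle _ (by linarith)
  obtain ⟨T, hT, hno⟩ := IsStrip.exists_life_span h hs ht₁ ha hm hlow
  obtain ⟨γ₁, γ₂, hS⟩ := h.exists_isStrip hs ht₁ hT hu ha.le hw
  exact hno γ₁ γ₂ hS

/-- A solution that is hyperbolic at one time, and exists for all later times, is constant. -/
theorem eq_const (h : PSol s s' t₀ u v ux vx uxx vxx) (hs : SonicData s s' α β)
    (ht₁ : t₀ < t₁) (hu : ∀ x, u t₁ x < α) :
    ∀ t ≥ t₁, ∀ x, u t x = u t₁ 0 ∧ v t x = v t₁ 0 := by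
  have hle : ∀ t ≥ t₁, ∀ x, u t x ≤ α := by
    by_cases hc : ∀ x y, riem s α u v t₁ x = riem s α u v t₁ y
    · exact h.le_of_riem_const hs ht₁ hu hc
    by_cases hc' : ∀ x y, riem s α (fun t x => u t (-x)) (fun t x => -v t (-x)) t₁ x =
      riem s α (fun t x => u t (-x)) (fun t x => -v t (-x)) t₁ y
    · intro t ht x
      have := h.reflect.le_of_riem_const hs ht₁ (fun x => hu (-x)) hc' t ht (-x)
      rwa [neg_neg] at this
    · exact h.le_of_riem_not_const hs ht₁ hu hc hc'
  have hc := h.riem_const_of_le hs ht₁ hu hle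
  have hc' := h.reflect.riem_const_of_le hs ht₁ (fun x => hu (-x)) fun t ht x => hle t ht (-x)
  intro t ht x
  have hmem := right_mem_Icc.2 ht
  have h1 : riem s α u v t x = riem s α u v t₁ 0 := le_antisymm
    (h.riem_le hs ht₁ (fun r hr z => hle r hr.1 z) (fun z => (hc z 0).le) t hmem x)
    (h.le_riem hs ht₁ (fun r hr z => hle r hr.1 z) (fun z => (hc 0 z).le) t hmem x)
  have h2 := le_antisymm
    (h.reflect.riem_le hs ht₁ (fun r hr z => hle r hr.1 (-z)) (fun z => (hc' z (-0)).le) t hmem (-x))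
    (h.reflect.le_riem hs ht₁ (fun r hr z => hle r hr.1 (-z)) (fun z => (hc' (-0) z).le) t hmem (-x))
  have h3 := riem_add_riem_reflect (s := s) (α := α) (u := u) (v := v) t x
  have h4 := riem_add_riem_reflect (s := s) (α := α) (u := u) (v := v) t₁ 0
  have h5 : u t x = u t₁ 0 :=
    hs.speedInt_strictMonoOn.injOn (hle t ht x) (hu 0).le (by linarith)
  refine ⟨h5, ?_⟩
  simp only [riem, h5] at h1
  linarith

end PSol

/-! ### From classical solutions to `PSol`, and back to the initial time -/

/-- The partial derivatives of order at most two of a `C²` function on an open half-plane. -/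
theorem ContDiffOn.partials {f : ℝ → ℝ → ℝ} {t₀ : ℝ}
    (hf : ContDiffOn ℝ 2 (fun p : ℝ × ℝ => f p.1 p.2) (Ioi t₀ ×ˢ univ)) :
    (∀ t, t₀ < t → ∀ x, HasFDerivAt (fun p : ℝ × ℝ => f p.1 p.2)
      (pairing (deriv (fun r => f r x) t) (deriv (f t) x)) (t, x)) ∧
    (∀ t, t₀ < t → ∀ x, HasFDerivAt (fun p : ℝ × ℝ => deriv (f p.1) p.2)
      (pairing (deriv (fun y => deriv (fun r => f r y) t) x) (deriv (fun y => deriv (f t) y) x))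
      (t, x)) ∧
    ContinuousOn (fun p : ℝ × ℝ => deriv (fun y => deriv (f p.1) y) p.2) (Ioi t₀ ×ˢ univ) := by
  set F : ℝ × ℝ → ℝ := fun p => f p.1 p.2 with hF
  have hopen : IsOpen (Ioi t₀ ×ˢ (univ : Set ℝ)) := isOpen_Ioi.prod isOpen_univ
  have hat : ∀ p ∈ Ioi t₀ ×ˢ (univ : Set ℝ), ContDiffAt ℝ 2 F p := fun p hp =>
    hf.contDiffAt (hopen.mem_nhds hp)
  have hpair : ∀ A : ℝ × ℝ →L[ℝ] ℝ, A = pairing (A (1, 0)) (A (0, 1)) := by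
    intro A; ext <;> simp
  have hd : ∀ p ∈ Ioi t₀ ×ˢ (univ : Set ℝ),
      HasFDerivAt F (pairing (fderiv ℝ F p (1, 0)) (fderiv ℝ F p (0, 1))) p := fun p hp => by
    rw [← hpair]; exact ((hat p hp).differentiableAt (by norm_num)).hasFDerivAt
  have hx : ∀ t, t₀ < t → ∀ x, deriv (f t) x = fderiv ℝ F (t, x) (0, 1) := fun t ht x =>
    (hd (t, x) ⟨ht, trivial⟩).snd_deriv.deriv
  have htd : ∀ t, t₀ < t → ∀ x, deriv (fun r => f r x) t = fderiv ℝ F (t, x) (1, 0) :=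
    fun t ht x => (hd (t, x) ⟨ht, trivial⟩).fst_deriv.deriv
  have hd2 : ∀ p ∈ Ioi t₀ ×ˢ (univ : Set ℝ),
      HasFDerivAt (fderiv ℝ F) (fderiv ℝ (fderiv ℝ F) p) p := fun p hp =>
    (((hat p hp).fderiv_right (m := 1) (by norm_num)).differentiableAt (by norm_num)).hasFDerivAt
  have happ : ∀ p ∈ Ioi t₀ ×ˢ (univ : Set ℝ), ∀ e : ℝ × ℝ,
      HasFDerivAt (fun q => fderiv ℝ F q e)
        (pairing (fderiv ℝ (fderiv ℝ F) p (1, 0) e) (fderiv ℝ (fderiv ℝ F) p (0, 1) e)) p := by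
    intro p hp e
    refine ((hd2 p hp).clm_apply (hasFDerivAt_const e p)).congr_fderiv ?_
    ext <;> simp
  have hsymm : ∀ p ∈ Ioi t₀ ×ˢ (univ : Set ℝ),
      fderiv ℝ (fderiv ℝ F) p (1, 0) (0, 1) = fderiv ℝ (fderiv ℝ F) p (0, 1) (1, 0) :=
    fun p hp => (hat p hp).isSymmSndFDerivAt (by simp) _ _
  have hxx : ∀ p ∈ Ioi t₀ ×ˢ (univ : Set ℝ),
      deriv (fun y => deriv (f p.1) y) p.2 = fderiv ℝ (fderiv ℝ F) p (0, 1) (0, 1) := by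
    intro p hp
    rw [funext (hx p.1 hp.1)]
    exact (HasFDerivAt.snd_deriv (f := fun t x => fderiv ℝ F (t, x) (0, 1)) (t := p.1) (x := p.2)
      (happ p hp (0, 1))).deriv
  refine ⟨fun t ht x => ?_, fun t ht x => ?_, ?_⟩
  · rw [hx t ht, htd t ht]; exact hd (t, x) ⟨ht, trivial⟩
  · have hp : ((t, x) : ℝ × ℝ) ∈ Ioi t₀ ×ˢ (univ : Set ℝ) := ⟨ht, trivial⟩
    have h1 : deriv (fun y => deriv (fun r => f r y) t) x =
        fderiv ℝ (fderiv ℝ F) (t, x) (1, 0) (0, 1) := by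
      rw [funext (htd t ht), hsymm _ hp]
      exact (HasFDerivAt.snd_deriv (f := fun t x => fderiv ℝ F (t, x) (1, 0))
        (happ (t, x) hp (1, 0))).deriv
    rw [h1, hxx (t, x) hp]
    refine (happ (t, x) hp (0, 1)).congr_of_eventuallyEq ?_
    filter_upwards [hopen.mem_nhds hp] with q hq
    exact hx q.1 hq.1 q.2
  · have hc : ContinuousOn (fun p => fderiv ℝ (fderiv ℝ F) p (0, 1) (0, 1))
        (Ioi t₀ ×ˢ (univ : Set ℝ)) := by
      intro p hp
      have h1 : ContDiffAt ℝ 0 (fderiv ℝ (fderiv ℝ F)) p :=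
        ((hat p hp).fderiv_right (m := 1) (by norm_num)).fderiv_right (m := 0) (by norm_num)
      exact ((h1.continuousAt.clm_apply continuousAt_const).clm_apply
        continuousAt_const).continuousWithinAt
    exact hc.congr hxx

namespace IsPSystemSolution

variable {σ : ℝ → ℝ} {t₀ : ℝ} {u v : ℝ → ℝ → ℝ}

/-- The equations for u_x and v_x follow by differentiating the system in x and using symmetry of
second derivatives. For t > t₀ the one-sided time derivatives are ordinary ones. -/
theorem pSol (h : IsPSystemSolution σ t₀ u v) (hσ : ContDiff ℝ 2 σ) :
    PSol (deriv σ) (deriv (deriv σ)) t₀ u v (fun t x => deriv (u t) x) (fun t x => deriv (v t) x)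
      (fun t x => deriv (fun y => deriv (u t) y) x)
      (fun t x => deriv (fun y => deriv (v t) y) x) := by
  have hsub : Ioi t₀ ×ˢ (univ : Set ℝ) ⊆ Ici t₀ ×ˢ univ := prod_mono Ioi_subset_Ici_self subset_rfl
  obtain ⟨u1, u2, u3⟩ := (h.contDiffOn_u.mono hsub).partials
  obtain ⟨v1, v2, v3⟩ := (h.contDiffOn_v.mono hsub).partials
  have hσ1 : ∀ w, HasDerivAt σ (deriv σ w) w := fun w =>
    (hσ.differentiable (by norm_num) w).hasDerivAt
  have hσ2 : ∀ w, HasDerivAt (deriv σ) (deriv (deriv σ) w) w := fun w =>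
    ((hσ.deriv' (n := 1)).differentiable (by norm_num) w).hasDerivAt
  have hut : ∀ t, t₀ < t → ∀ x, deriv (fun r => u r x) t = -deriv (v t) x := fun t ht x => by
    rw [← derivWithin_of_mem_nhds (Ici_mem_nhds ht)]
    exact h.eq_u t ht.le x
  have hvt : ∀ t, t₀ < t → ∀ x, deriv (fun r => v r x) t = deriv σ (u t x) * deriv (u t) x :=
    fun t ht x => by
      rw [← derivWithin_of_mem_nhds (Ici_mem_nhds ht), h.eq_v t ht.le x]
      exact ((hσ1 (u t x)).comp x (u1 t ht x).snd_deriv).deriv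
  refine ⟨fun t ht x => ?_, fun t ht x => ?_, fun t ht x => ?_, fun t ht x => ?_, u3, v3,
    fun t ht => h.periodic_u t ht.le, fun t ht => h.periodic_v t ht.le⟩
  · rw [← hut t ht]; exact u1 t ht x
  · rw [← hvt t ht]; exact v1 t ht x
  · have := u2 t ht x
    rw [funext (hut t ht), deriv.fun_neg] at this
    exact this
  · have := v2 t ht x
    rw [funext (hvt t ht)] at this
    have h1 := (((hσ2 (u t x)).comp x (u1 t ht x).snd_deriv).mul
      (HasFDerivAt.snd_deriv (f := fun t x => deriv (u t) x) (u2 t ht x))).deriv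
    simp only [Function.comp_def, Pi.mul_def] at h1
    rw [h1] at this
    convert this using 2
    ring

/-- This symmetry carries the component u > β of the cubic case to a component to the left of a
sonic point. -/
theorem neg (h : IsPSystemSolution σ t₀ u v) :
    IsPSystemSolution (fun w => -σ (-w)) t₀ (fun t x => -u t x) (fun t x => -v t x) where
  contDiffOn_u := h.contDiffOn_u.neg
  contDiffOn_v := h.contDiffOn_v.neg
  periodic_u t ht x := by rw [h.periodic_u t ht]
  periodic_v t ht x := by rw [h.periodic_v t ht]
  eq_u t ht x := by
    rw [derivWithin.fun_neg, deriv.fun_neg, h.eq_u t ht x]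
  eq_v t ht x := by
    simp only [neg_neg]
    rw [derivWithin.fun_neg, deriv.fun_neg, h.eq_v t ht x]

/-- Hyperbolicity persists for a short time by compactness of a period. Constancy holds from every
t₁ slightly later than t₀, and t₁ → t₀ with continuity up to the boundary gives the claim. -/
theorem eq_const_of_lt (h : IsPSystemSolution σ t₀ u v) (hσ : ContDiff ℝ 2 σ) {α β : ℝ}
    (hs : SonicData (deriv σ) (deriv (deriv σ)) α β) (hu : ∀ x, u t₀ x < α) :
    ∃ a b : ℝ, ∀ t, t₀ ≤ t → ∀ x, u t x = a ∧ v t x = b := by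
  have hsol := h.pSol hσ
  -- hyperbolicity persists for a short time
  have hnear : ∀ᶠ t in 𝓝[≥] t₀, ∀ x, u t x < α := by
    have h1 : ∀ᶠ t in 𝓝[≥] t₀, ∀ x ∈ Icc (0 : ℝ) 1, u t x < α := by
      have hprod : {p : ℝ × ℝ | u p.1 p.2 < α} ∈ 𝓝[≥] t₀ ×ˢ 𝓝ˢ (Icc (0 : ℝ) 1) := by
        refine isCompact_Icc.mem_prod_nhdsSet_of_forall fun x _ => ?_
        have hc := (h.contDiffOn_u.continuousOn (t₀, x) ⟨self_mem_Ici, trivial⟩).eventually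
          (gt_mem_nhds (hu x))
        rwa [nhdsWithin_prod_eq, nhdsWithin_univ] at hc
      exact (Eventually.curry hprod).mono fun _ ht => ht.self_of_nhdsSet
    filter_upwards [h1, self_mem_nhdsWithin] with t ht ht0 x
    obtain ⟨y, hy, hxy⟩ := exists_mem_Icc_periodic (h.periodic_u t ht0) x
    rw [← hxy]; exact ht y hy
  have hnear' : ∀ᶠ t in 𝓝[>] t₀, t₀ < t ∧ ∀ x, u t x < α :=
    eventually_mem_nhdsWithin.and (hnear.filter_mono (nhdsWithin_mono _ Ioi_subset_Ici_self))
  have hconst : ∀ᶠ r in 𝓝[>] t₀, ∀ t ≥ r, ∀ x, u t x = u r 0 ∧ v t x = v r 0 :=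
    hnear'.mono fun r hr => hsol.eq_const hs hr.1 hr.2
  have hlim : ∀ {f : ℝ → ℝ → ℝ},
      ContDiffOn ℝ 2 (fun p : ℝ × ℝ => f p.1 p.2) (Ici t₀ ×ˢ univ) → ∀ x,
      Tendsto (fun r => f r x) (𝓝[>] t₀) (𝓝 (f t₀ x)) := by
    intro f hf x
    have h1 : ContinuousOn (fun r => f r x) (Ici t₀) := hf.continuousOn.comp
      (f := fun r : ℝ => (r, x)) (by fun_prop) fun r hr => ⟨hr, trivial⟩
    exact (h1 t₀ self_mem_Ici).mono_left (nhdsWithin_mono _ Ioi_subset_Ici_self)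
  refine ⟨u t₀ 0, v t₀ 0, fun t ht x => ?_⟩
  rcases ht.eq_or_lt with rfl | ht
  · exact ⟨tendsto_nhds_unique_of_eventuallyEq (hlim h.contDiffOn_u x) (hlim h.contDiffOn_u 0)
        (hconst.mono fun r hr => (hr r le_rfl x).1),
      tendsto_nhds_unique_of_eventuallyEq (hlim h.contDiffOn_v x) (hlim h.contDiffOn_v 0)
        (hconst.mono fun r hr => (hr r le_rfl x).2)⟩
  · have hev := hconst.and (Ioo_mem_nhdsGT ht)
    exact ⟨tendsto_nhds_unique_of_eventuallyEq tendsto_const_nhds (hlim h.contDiffOn_u 0)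
        (hev.mono fun r hr => (hr.1 t hr.2.2.le x).1),
      tendsto_nhds_unique_of_eventuallyEq tendsto_const_nhds (hlim h.contDiffOn_v 0)
        (hev.mono fun r hr => (hr.1 t hr.2.2.le x).2)⟩

end IsPSystemSolution

/-! ### The two types of stress function -/

theorem ContDiff.hasDerivAt_deriv {σ : ℝ → ℝ} (hσ : ContDiff ℝ 2 σ) (w : ℝ) :
    HasDerivAt (deriv σ) (deriv (deriv σ) w) w :=
  ((hσ.deriv' (n := 1)).differentiable (by norm_num) w).hasDerivAt

theorem ContDiff.continuous_deriv_deriv {σ : ℝ → ℝ} (hσ : ContDiff ℝ 2 σ) :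
    Continuous (deriv (deriv σ)) :=
  (hσ.deriv' (n := 1)).continuous_deriv (by norm_num)

/-- σ' is strictly increasing and vanishes at the minimum, so it is nonnegative on all of [α, ∞);
the right end α + 1 is arbitrary. -/
theorem IsQuadraticLike.sonicData {σ : ℝ → ℝ} {α : ℝ} (h : IsQuadraticLike σ α) :
    SonicData (deriv σ) (deriv (deriv σ)) α (α + 1) := by
  have hmono : StrictMonoOn (deriv σ) univ := h.strictConvex.strictMonoOn_deriv fun x _ =>
    h.contDiff.differentiable (by norm_num) x
  have hzero : deriv σ α = 0 :=
    IsLocalMin.deriv_eq_zero (Eventually.of_forall h.isMin)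
  exact ⟨h.contDiff.hasDerivAt_deriv, h.contDiff.continuous_deriv_deriv,
    hmono.mono (subset_univ _), hzero, by linarith,
    fun w hw => hzero ▸ hmono.monotoneOn trivial trivial hw.1⟩

namespace IsCubicLike

variable {σ : ℝ → ℝ} {α β : ℝ}

/-- The definition gives no value of σ' at α or β; continuity and the signs on either side of α give
σ'(α) = 0, and the sign on (α, β) gives σ'(β) ≥ 0. -/
theorem sonicData (h : IsCubicLike σ α β) : SonicData (deriv σ) (deriv (deriv σ)) α β := by
  have hc : Continuous (deriv σ) :=
    continuous_iff_continuousAt.2 fun w => (h.contDiff.hasDerivAt_deriv w).continuousAt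
  have hα : 0 ≤ deriv σ α := by
    refine ge_of_tendsto ((hc.tendsto α).mono_left nhdsWithin_le_nhds : Tendsto _ (𝓝[>] α) _) ?_
    filter_upwards [Ioo_mem_nhdsGT h.lt] with w hw
    exact (h.deriv_pos w hw.1 hw.2).le
  have hα' : deriv σ α ≤ 0 := by
    refine le_of_tendsto ((hc.tendsto α).mono_left nhdsWithin_le_nhds : Tendsto _ (𝓝[<] α) _) ?_
    filter_upwards [self_mem_nhdsWithin] with w hw
    exact (h.deriv_neg_left w hw).le
  have hβ : 0 ≤ deriv σ β := by
    refine ge_of_tendsto ((hc.tendsto β).mono_left nhdsWithin_le_nhds : Tendsto _ (𝓝[<] β) _) ?_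
    filter_upwards [Ioo_mem_nhdsLT h.lt] with w hw
    exact (h.deriv_pos w hw.1 hw.2).le
  refine ⟨h.contDiff.hasDerivAt_deriv, h.contDiff.continuous_deriv_deriv, ?_,
    le_antisymm hα' hα, h.lt, fun w hw => ?_⟩
  · refine strictMonoOn_of_deriv_pos (convex_Iic α) hc.continuousOn fun w hw => ?_
    rw [interior_Iic] at hw
    exact h.deriv_deriv_pos w (le_of_lt hw)
  · rcases hw.1.eq_or_lt with rfl | h1
    · exact hα
    rcases hw.2.eq_or_lt with rfl | h2
    · exact hβ
    exact (h.deriv_pos w h1 h2).le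

theorem neg (h : IsCubicLike σ α β) : IsCubicLike (fun w => -σ (-w)) (-β) (-α) := by
  have h1 : deriv (fun w => -σ (-w)) = fun w => deriv σ (-w) := by
    funext w; rw [deriv.fun_neg, deriv_comp_neg, neg_neg]
  have h2 : deriv (fun w => deriv σ (-w)) = fun w => -deriv (deriv σ) (-w) := by
    funext w; rw [deriv_comp_neg]
  refine ⟨(h.contDiff.comp contDiff_neg).neg, neg_lt_neg h.lt, ?_, ?_, ?_, ?_, ?_⟩ <;>
    simp only [h1, h2]
  · exact fun w hw => h.deriv_neg_right _ (by linarith)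
  · exact fun w hw => h.deriv_neg_left _ (by linarith)
  · exact fun w hw hw' => h.deriv_pos _ (by linarith) (by linarith)
  · exact fun w hw => neg_pos.2 (h.deriv_deriv_neg _ (by linarith))
  · exact fun w hw => neg_lt_zero.2 (h.deriv_deriv_pos _ (by linarith))

end IsCubicLike

theorem theorem1 (σ : ℝ → ℝ) (t₀ : ℝ) (u v : ℝ → ℝ → ℝ)
    (hsol : IsPSystemSolution σ t₀ u v)
    (hσ : (∃ α : ℝ, IsQuadraticLike σ α ∧ ∀ x, u t₀ x < α) ∨
      (∃ α β : ℝ, IsCubicLike σ α β ∧ ∀ x, u t₀ x < α ∨ β < u t₀ x)) :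
    ∃ a b : ℝ, ∀ t, t₀ ≤ t → ∀ x, u t x = a ∧ v t x = b := by
  rcases hσ with ⟨α, hσ, hu⟩ | ⟨α, β, hσ, hu⟩
  · exact hsol.eq_const_of_lt hσ.contDiff hσ.sonicData hu
  have hcont : Continuous (u t₀) := by
    rw [← continuousOn_univ]
    exact hsol.contDiffOn_u.continuousOn.comp (f := fun x : ℝ => (t₀, x)) (by fun_prop)
      fun x _ => ⟨self_mem_Ici, trivial⟩
  -- The initial profile is continuous on a connected line, so it cannot visit both components of H
  -- without taking a value in [α, β].
  have hcases : (∀ x, u t₀ x < α) ∨ ∀ x, β < u t₀ x := by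
    by_contra! hcon
    obtain ⟨⟨x, hx⟩, y, hy⟩ := hcon
    have hx' : β < u t₀ x := (hu x).resolve_left hx.not_gt
    have hy' : u t₀ y < α := (hu y).resolve_right hy.not_gt
    obtain ⟨z, -, hz⟩ := intermediate_value_uIcc (hcont.continuousOn (s := uIcc y x))
      (Icc_subset_uIcc ⟨hy'.le, hσ.lt.le.trans hx'.le⟩)
    rcases hu z with h | h <;> linarith [hσ.lt]
  rcases hcases with hlt | hgt
  · exact hsol.eq_const_of_lt hσ.contDiff hσ.sonicData hlt
  · obtain ⟨a, b, hab⟩ := hsol.neg.eq_const_of_lt hσ.neg.contDiff hσ.neg.sonicData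
      fun x => neg_lt_neg (hgt x)
    exact ⟨-a, -b, fun t ht x => ⟨neg_eq_iff_eq_neg.1 (hab t ht x).1,
      neg_eq_iff_eq_neg.1 (hab t ht x).2⟩⟩
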